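/- Let $X$ be a threefold isogenous to a product of curves of unmixed type, i.e. $X=(C_1\times C_2\times C_3)/G$, where $C_1,C_2,C_3$ are compact Riemann surfaces (equivalently, smooth projective complex curves) of genus at least $2$ and $G\subset \mathrm{Aut}(C_1)\times\mathrm{Aut}(C_2)\times\mathrm{Aut}(C_3)$ is a finite group acting diagonally and freely on $C_1\times C_2\times C_3$; such a presentation is called a realization of $X$. Let $\psi_i\colon G\to\mathrm{Aut}(C_i)$ be the action on the $i$-th factor and $K_i=\ker\psi_i$. The realization is called minimal if $K_i\cap K_j=\{1\}$ for all $1\le i<j\le 3$. Then $X$ has a minimal realization. More precisely, for every realization of $X$ as above put $K_{i,j}=K_i\cap K_j$, $K=K_{1,2}\cdot K_{1,3}\cdot K_{2,3}\trianglelefteq G$ and $H=G/K$. Then the quotients $C_1/K_{2,3}$, $C_2/K_{1,3}$, $C_3/K_{1,2}$ are compact Riemann surfaces of genus at least $2$, the induced diagonal action of $H$ on their product is faithful and free, the quotient map $C_1\times C_2\times C_3\to X$ induces an isomorphism $$X\cong \frac{C_1/K_{2,3}\times C_2/K_{1,3}\times C_3/K_{1,2}}{H},$$ and this realization of $X$ is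 minimal. -/

import Mathlib

open scoped Manifold ContDiff
open TopologicalSpace

universe u v

noncomputable section

/-! ### The genus of a compact Riemann surface

The genus is `dim H¹(C, 𝒪)`, where `𝒪` is the sheaf of holomorphic functions. The first Čech
cohomology is the direct limit of the groups `H¹(𝒰, 𝒪)` over the open covers `𝒰`.
Covers of the form `(U x)` for `x` in `C`, with `x ∈ U x`, are cofinal among all open covers, and
the direct limit is taken over those; for `V x ⊆ U x` the refinement map is the identity on
indices. -/

section Cech

variable (C : Type u) [TopologicalSpace C] [ChartedSpace ℂ C]

/-- Open covers of `C` indexed by the points of `C`, the set with index `x` containing `x`. -/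
abbrev PointedCover : Type u := {U : C → Opens C // ∀ x, x ∈ U x}

variable {C}

/-- `c x y`, restricted to `U x ∩ U y`, is a Čech 1-cocycle of holomorphic functions for the cover
`U`. (The values of `c x y` off `U x ∩ U y` play no role.) -/
def IsCechCocycle (U : PointedCover C) (c : C → C → C → ℂ) : Prop :=
  (∀ x y, ContMDiffOn 𝓘(ℂ) 𝓘(ℂ) ω (c x y) (U.1 x ∩ U.1 y : Set C)) ∧
  ∀ x y z, ∀ p ∈ (U.1 x ∩ U.1 y ∩ U.1 z : Set C), c x y p + c y z p = c x z p

/-- `c x y`, restricted to `U x ∩ U y`, is the Čech coboundary of a 0-cochain of holomorphic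
functions for the cover `U`. -/
def IsCechCoboundary (U : PointedCover C) (c : C → C → C → ℂ) : Prop :=
  ∃ h : C → C → ℂ, (∀ x, ContMDiffOn 𝓘(ℂ) 𝓘(ℂ) ω (h x) (U.1 x : Set C)) ∧
    ∀ x y, ∀ p ∈ (U.1 x ∩ U.1 y : Set C), c x y p = h y p - h x p

theorem IsCechCocycle.mono {U V : PointedCover C} {c : C → C → C → ℂ} (h : IsCechCocycle U c)
    (hVU : ∀ x, V.1 x ≤ U.1 x) : IsCechCocycle V c :=
  ⟨fun x y => (h.1 x y).mono (Set.inter_subset_inter (hVU x) (hVU y)),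
    fun x y z p hp => h.2 x y z p ⟨⟨hVU x hp.1.1, hVU y hp.1.2⟩, hVU z hp.2⟩⟩

theorem IsCechCoboundary.mono {U V : PointedCover C} {c : C → C → C → ℂ}
    (h : IsCechCoboundary U c) (hVU : ∀ x, V.1 x ≤ U.1 x) : IsCechCoboundary V c := by
  obtain ⟨f, hf, hc⟩ := h
  exact ⟨f, fun x => (hf x).mono (hVU x), fun x y p hp => hc x y p ⟨hVU x hp.1, hVU y hp.2⟩⟩

/-- The common refinement of two covers. -/
def PointedCover.inf (U V : PointedCover C) : PointedCover C :=
  ⟨fun x => U.1 x ⊓ V.1 x, fun x => ⟨U.2 x, V.2 x⟩⟩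

theorem contMDiffOn_const_mul {s : Set C} {f : C → ℂ} (a : ℂ)
    (hf : ContMDiffOn 𝓘(ℂ) 𝓘(ℂ) ω f s) : ContMDiffOn 𝓘(ℂ) 𝓘(ℂ) ω (fun p => a * f p) s :=
  ((contDiff_const.mul contDiff_id).contMDiff (f := fun z : ℂ => a * z)).comp_contMDiffOn hf

theorem isCechCocycle_zero (U : PointedCover C) : IsCechCocycle U 0 :=
  ⟨fun _ _ => contMDiffOn_const, fun _ _ _ _ _ => by simp⟩

theorem isCechCoboundary_zero (U : PointedCover C) : IsCechCoboundary U 0 :=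
  ⟨0, fun _ => contMDiffOn_const, fun _ _ _ _ => by simp⟩

theorem IsCechCocycle.add {U : PointedCover C} {c d : C → C → C → ℂ} (hc : IsCechCocycle U c)
    (hd : IsCechCocycle U d) : IsCechCocycle U (c + d) :=
  ⟨fun x y => (hc.1 x y).add (hd.1 x y), fun x y z p hp => by
    have h1 := hc.2 x y z p hp
    have h2 := hd.2 x y z p hp
    simp only [Pi.add_apply]
    linear_combination h1 + h2⟩

theorem IsCechCoboundary.add {U : PointedCover C} {c d : C → C → C → ℂ}
    (hc : IsCechCoboundary U c) (hd : IsCechCoboundary U d) : IsCechCoboundary U (c + d) := by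
  obtain ⟨f, hf, hcf⟩ := hc
  obtain ⟨g, hg, hdg⟩ := hd
  refine ⟨f + g, fun x => (hf x).add (hg x), fun x y p hp => ?_⟩
  have h1 := hcf x y p hp
  have h2 := hdg x y p hp
  simp only [Pi.add_apply]
  linear_combination h1 + h2

theorem IsCechCocycle.smul {U : PointedCover C} {c : C → C → C → ℂ} (a : ℂ)
    (hc : IsCechCocycle U c) : IsCechCocycle U (a • c) :=
  ⟨fun x y => contMDiffOn_const_mul a (hc.1 x y), fun x y z p hp => by
    have h1 := hc.2 x y z p hp
    simp only [Pi.smul_apply, smul_eq_mul]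
    linear_combination a * h1⟩

theorem IsCechCoboundary.smul {U : PointedCover C} {c : C → C → C → ℂ} (a : ℂ)
    (hc : IsCechCoboundary U c) : IsCechCoboundary U (a • c) := by
  obtain ⟨f, hf, hcf⟩ := hc
  refine ⟨a • f, fun x => contMDiffOn_const_mul a (hf x), fun x y p hp => ?_⟩
  have h1 := hcf x y p hp
  simp only [Pi.smul_apply, smul_eq_mul]
  linear_combination a * h1

variable (C)

/-- The cochains that are 1-cocycles for some cover. -/
def cechCocycles : Submodule ℂ (C → C → C → ℂ) where
  carrier := {c | ∃ U : PointedCover C, IsCechCocycle U c}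
  zero_mem' := ⟨⟨fun _ => ⊤, fun _ => trivial⟩, isCechCocycle_zero _⟩
  add_mem' := by
    rintro c d ⟨U, hc⟩ ⟨V, hd⟩
    exact ⟨U.inf V, (hc.mono fun _ => inf_le_left).add (hd.mono fun _ => inf_le_right)⟩
  smul_mem' := by
    rintro a c ⟨U, hc⟩
    exact ⟨U, hc.smul a⟩

/-- The cochains that become a coboundary for some cover; in particular this contains the cochains
that vanish after passing to a finer cover. -/
def cechCoboundaries : Submodule ℂ (C → C → C → ℂ) where
  carrier := {c | ∃ U : PointedCover C, IsCechCoboundary U c}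
  zero_mem' := ⟨⟨fun _ => ⊤, fun _ => trivial⟩, isCechCoboundary_zero _⟩
  add_mem' := by
    rintro c d ⟨U, hc⟩ ⟨V, hd⟩
    exact ⟨U.inf V, (hc.mono fun _ => inf_le_left).add (hd.mono fun _ => inf_le_right)⟩
  smul_mem' := by
    rintro a c ⟨U, hc⟩
    exact ⟨U, hc.smul a⟩

/-- The first Čech cohomology `H¹(C, 𝒪)` of the sheaf of holomorphic functions: the direct limit of
`Z¹(U, 𝒪) / B¹(U, 𝒪)` over the covers `U`. -/
abbrev CechH1 : Type u :=
  cechCocycles C ⧸ (cechCoboundaries C).comap (cechCocycles C).subtype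

/-- The genus `dim H¹(C, 𝒪)` of a compact Riemann surface. -/
def genus : ℕ := Module.finrank ℂ (CechH1 C)

end Cech

/-! ### Compact Riemann surfaces and their automorphisms -/

/-- A compact Riemann surface: a compact connected Hausdorff complex manifold of dimension one
(that is, a smooth projective complex curve). -/
structure CompactRiemannSurface : Type (u + 1) where
  carrier : Type u
  [top : TopologicalSpace carrier]
  [charted : ChartedSpace ℂ carrier]
  [manifold : IsManifold 𝓘(ℂ) ω carrier]
  [hausdorff : T2Space carrier]
  [compact : CompactSpace carrier]
  [connected : ConnectedSpace carrier]

namespace CompactRiemannSurface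

instance : CoeSort CompactRiemannSurface.{u} (Type u) := ⟨carrier⟩

variable (C : CompactRiemannSurface.{u})

instance : TopologicalSpace C := C.top
instance : ChartedSpace ℂ C := C.charted
instance : IsManifold 𝓘(ℂ) ω C := C.manifold
instance : T2Space C := C.hausdorff
instance : CompactSpace C := C.compact
instance : ConnectedSpace C := C.connected

/-- The group `Aut C` of biholomorphic self-maps of `C`. -/
def Aut : Subgroup (Equiv.Perm C) where
  carrier := {σ | ContMDiff 𝓘(ℂ) 𝓘(ℂ) ω σ ∧ ContMDiff 𝓘(ℂ) 𝓘(ℂ) ω σ.symm}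
  one_mem' := ⟨contMDiff_id, contMDiff_id⟩
  mul_mem' := fun ha hb => ⟨ha.1.comp hb.1, hb.2.comp ha.2⟩
  inv_mem' := fun ha => ⟨ha.2, ha.1⟩

end CompactRiemannSurface

/-! ### Threefolds isogenous to a product of curves, of unmixed type -/

/-- A realization of the complex threefold `X` as a quotient `(C₁ × C₂ × C₃) / G`, where the `Cᵢ`
are compact Riemann surfaces of genus at least two and `G` is a finite group of automorphisms of
the product which acts diagonally (so `G ⊆ Aut C₁ × Aut C₂ × Aut C₃`) and freely.
That `X` is the quotient means that there is a surjective local biholomorphism from the product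
to `X` whose fibres are exactly the `G`-orbits.
`X` is isogenous to a product (of unmixed type) if it has a realization. -/
structure Realization (X : Type v) [TopologicalSpace X]
    [ChartedSpace (EuclideanSpace ℂ (Fin 3)) X] : Type (max (u + 1) v) where
  /-- The three curves. -/
  C : Fin 3 → CompactRiemannSurface.{u}
  two_le_genus : ∀ i, 2 ≤ genus (C i)
  /-- The group. -/
  G : Subgroup (∀ i, (C i).Aut)
  finite : Finite G
  free : ∀ g ∈ G, ∀ p : (∀ i, C i), (∀ i, (g i : Equiv.Perm (C i)) (p i) = p i) → g = 1
  /-- The quotient map. -/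
  proj : C 0 × C 1 × C 2 → X
  proj_surjective : Function.Surjective proj
  proj_isLocalDiffeomorph :
    IsLocalDiffeomorph (𝓘(ℂ).prod (𝓘(ℂ).prod 𝓘(ℂ))) 𝓘(ℂ, EuclideanSpace ℂ (Fin 3)) ω proj
  proj_eq_iff : ∀ p q : C 0 × C 1 × C 2, proj p = proj q ↔ ∃ g ∈ G,
    (g 0 : Equiv.Perm (C 0)) p.1 = q.1 ∧ (g 1 : Equiv.Perm (C 1)) p.2.1 = q.2.1 ∧
      (g 2 : Equiv.Perm (C 2)) p.2.2 = q.2.2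

namespace Realization

variable {X : Type v} [TopologicalSpace X] [ChartedSpace (EuclideanSpace ℂ (Fin 3)) X]

/-- The action `ψ i : G → Aut (C i)` on the `i`-th factor. -/
def ψ (R : Realization.{u} X) (i : Fin 3) : R.G →* (R.C i).Aut :=
  (Pi.evalMonoidHom _ i).comp R.G.subtype

/-- The kernel `K i` of the action on the `i`-th factor. -/
def K (R : Realization.{u} X) (i : Fin 3) : Subgroup R.G := (R.ψ i).ker

/-- The realization is minimal if the kernels intersect pairwise trivially. -/
def IsMinimal (R : Realization.{u} X) : Prop := ∀ i j, i < j → R.K i ⊓ R.K j = ⊥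

/-- The intersection of the two kernels other than `K k`. -/
def otherKernels (R : Realization.{u} X) (k : Fin 3) : Subgroup R.G :=
  ⨅ (i : Fin 3) (_ : i ≠ k), R.K i

/-- `S` arises from `R` by quotienting each factor `C k` by the intersection `K i ∩ K j` of the two
other kernels: the curves of `S` are the quotients `C k / (K i ∩ K j)` with quotient maps `q k`,
the group of `S` is the quotient of `G` by `(K 0 ∩ K 1) (K 0 ∩ K 2) (K 1 ∩ K 2)` with quotient map
`φ`, its action is the induced one, and so is its quotient map to `X`. -/
def IsQuotientByOtherKernels (R S : Realization.{u} X) : Prop :=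
  ∃ (q : ∀ k, R.C k → S.C k) (φ : R.G →* S.G),
    (∀ k, Function.Surjective (q k) ∧ IsLocalDiffeomorph 𝓘(ℂ) 𝓘(ℂ) ω (q k) ∧
      ∀ x y, q k x = q k y ↔ ∃ g ∈ R.otherKernels k, (R.ψ k g : Equiv.Perm (R.C k)) x = y) ∧
    Function.Surjective φ ∧ φ.ker = ⨆ k, R.otherKernels k ∧
    (∀ k g x, q k ((R.ψ k g : Equiv.Perm (R.C k)) x) =
      (S.ψ k (φ g) : Equiv.Perm (S.C k)) (q k x)) ∧
    ∀ p : R.C 0 × R.C 1 × R.C 2, R.proj p = S.proj (q 0 p.1, q 1 p.2.1, q 2 p.2.2)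

end Realization

end

set_option linter.unusedSectionVars false

/-! Write `L k` for `R.otherKernels k`. It acts trivially on the two factors other than `C k`, so
freeness of `G` on the product forces it to act freely on `C k`. Hence `C k → C k / L k` is an
unramified covering of compact Riemann surfaces. Elements of `L 0`, `L 1`, `L 2` act on different
coordinates, so their product realizes any prescribed triple of coordinate actions
(`exists_combined`). If `g` fixes a point of the product of the quotients, then on each coordinate
of a lift it agrees with some `l i ∈ L i`; by freeness `g = l 0 * l 1 * l 2`, which lies in the
subgroup `K` generated by the `L k`. So `G / K` acts freely. For minimality, let `g` act trivially
on the quotients of `C i` and `C j`. By connectedness it acts on all of `C i` as one `l ∈ L i`, and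
on all of `C j` as one `m ∈ L j` (`exists_uniform`). Then `(l * m)⁻¹ * g` is trivial on both curves,
so it lies in the third `L k`, and `g ∈ K`.

The analytic work is the bound on the genus of `C / Γ` for a finite group `Γ` of order `n` acting
freely. Averaging cochains and descending them shows that `H¹(C / Γ, 𝒪)` embeds in `H¹(C, 𝒪)` with
image containing the invariants. The dimension of the invariants is the average of the traces of
`Γ`, and a nontrivial element has trace `1` (`trace_h1Pullback`), a fixed-point-free case of the
holomorphic Lefschetz formula. The invariants therefore have dimension `1 + (g - 1) / n`, which
exceeds `1` when `g ≥ 2`.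

For that trace, use for a large `σ`-invariant divisor `D ≥ 0` the exact sequence `0 → H⁰(𝒪) →
H⁰(𝒪(D)) → 𝒪(D)/𝒪 → H¹(𝒪) → 0`. As `σ` moves every point, its trace on the principal parts is `0`,
so the traces on `H⁰(𝒪(D))` and `H¹(𝒪)` add up to `1`. Multiplication by a meromorphic `f` with `f ∘
σ = ζ f`, `ζ ≠ 1`, carries `D` to `D - div f` and multiplies the `H⁰` trace by `ζ`. Both divisors
give the same formula, so the `H⁰` trace is `0`. The meromorphic functions needed all come from the
finite dimension of `H¹(𝒪)`, which positive genus provides. -/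

noncomputable section

/-! ### Meromorphic functions on Riemann surfaces -/

section Meromorphic

open Filter Topology

variable {C : Type u} [TopologicalSpace C] [ChartedSpace ℂ C]

/-- `f` is holomorphic at `x`. -/
abbrev HolAt (f : C → ℂ) (x : C) : Prop := ContMDiffAt 𝓘(ℂ) 𝓘(ℂ) ω f x

/-- The expression of `f` in the preferred chart at `x`. -/
def inChart (x : C) (f : C → ℂ) : ℂ → ℂ := f ∘ (chartAt ℂ x).symm

/-- `f` is meromorphic at `x`. -/
def MeroAt (f : C → ℂ) (x : C) : Prop := MeromorphicAt (inChart x f) (chartAt ℂ x x)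

/-- The order of vanishing of `f` at `x`. -/
def ordAt (f : C → ℂ) (x : C) : WithTop ℤ := meromorphicOrderAt (inChart x f) (chartAt ℂ x x)

/-- The local coordinate at `x` given by the preferred chart. -/
def coordAt (x : C) : C → ℂ := fun p => chartAt ℂ x p - chartAt ℂ x x

theorem contDiffAt_omega_iff_analyticAt {f : ℂ → ℂ} {z : ℂ} :
    ContDiffAt ℂ ω f z ↔ AnalyticAt ℂ f z := by
  rw [← contDiffWithinAt_univ, contDiffWithinAt_omega_iff_analyticWithinAt,
    analyticWithinAt_univ]

theorem eventually_nhdsNE_chart {x : C} {Q : C → Prop} :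
    (∀ᶠ z in 𝓝[≠] (chartAt ℂ x x), Q ((chartAt ℂ x).symm z)) ↔ ∀ᶠ p in 𝓝[≠] x, Q p := by
  set e := chartAt ℂ x
  have hx : x ∈ e.source := mem_chart_source ℂ x
  rw [eventually_nhdsWithin_iff, eventually_nhdsWithin_iff, ← e.map_nhds_eq hx, eventually_map]
  refine eventually_congr ?_
  filter_upwards [e.open_source.mem_nhds hx] with p hp
  simp only [Set.mem_compl_iff, Set.mem_singleton_iff, e.left_inv hp,
    e.injOn.eq_iff hp hx]

theorem inChart_eventuallyEq {f g : C → ℂ} {x : C} (h : f =ᶠ[𝓝[≠] x] g) :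
    inChart x f =ᶠ[𝓝[≠] (chartAt ℂ x x)] inChart x g :=
  eventually_nhdsNE_chart.2 h

theorem MeroAt.congr {f g : C → ℂ} {x : C} (hf : MeroAt f x) (h : f =ᶠ[𝓝[≠] x] g) : MeroAt g x :=
  MeromorphicAt.congr hf (inChart_eventuallyEq h)

theorem ordAt_congr {f g : C → ℂ} {x : C} (h : f =ᶠ[𝓝[≠] x] g) : ordAt f x = ordAt g x :=
  meromorphicOrderAt_congr (inChart_eventuallyEq h)

theorem ordAt_eq_top_iff {f : C → ℂ} {x : C} : ordAt f x = ⊤ ↔ ∀ᶠ p in 𝓝[≠] x, f p = 0 := by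
  rw [ordAt, meromorphicOrderAt_eq_top_iff]
  exact eventually_nhdsNE_chart (Q := fun p => f p = 0)

theorem MeroAt.ordAt_ne_top_iff {f : C → ℂ} {x : C} (hf : MeroAt f x) :
    ordAt f x ≠ ⊤ ↔ ∀ᶠ p in 𝓝[≠] x, f p ≠ 0 := by
  rw [ordAt, meromorphicOrderAt_ne_top_iff_eventually_ne_zero hf]
  exact eventually_nhdsNE_chart (Q := fun p => f p ≠ 0)

theorem MeroAt.add {f g : C → ℂ} {x : C} (hf : MeroAt f x) (hg : MeroAt g x) : MeroAt (f + g) x :=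
  MeromorphicAt.add hf hg

theorem MeroAt.mul {f g : C → ℂ} {x : C} (hf : MeroAt f x) (hg : MeroAt g x) : MeroAt (f * g) x :=
  MeromorphicAt.mul hf hg

theorem MeroAt.inv {f : C → ℂ} {x : C} (hf : MeroAt f x) : MeroAt f⁻¹ x :=
  MeromorphicAt.inv hf

theorem MeroAt.const_smul {f : C → ℂ} {x : C} (a : ℂ) (hf : MeroAt f x) : MeroAt (a • f) x :=
  MeromorphicAt.const_smul hf a

theorem meroAt_const (a : ℂ) (x : C) : MeroAt (fun _ => a) x := MeromorphicAt.const a _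

theorem ordAt_mul {f g : C → ℂ} {x : C} (hf : MeroAt f x) (hg : MeroAt g x) :
    ordAt (f * g) x = ordAt f x + ordAt g x :=
  meromorphicOrderAt_mul hf hg

theorem ordAt_inv {f : C → ℂ} {x : C} : ordAt f⁻¹ x = - ordAt f x :=
  meromorphicOrderAt_inv

theorem tendsto_nhdsNE_chart {x : C} {f : C → ℂ} {l : Filter ℂ} :
    Tendsto (inChart x f) (𝓝[≠] (chartAt ℂ x x)) l ↔ Tendsto f (𝓝[≠] x) l :=
  forall₂_congr fun s _ => eventually_nhdsNE_chart (Q := fun p => f p ∈ s)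

theorem MeroAt.tendsto_cobounded_iff {f : C → ℂ} {x : C} (hf : MeroAt f x) :
    Tendsto f (𝓝[≠] x) (Bornology.cobounded ℂ) ↔ ordAt f x < 0 := by
  rw [ordAt, ← tendsto_cobounded_iff_meromorphicOrderAt_neg hf, tendsto_nhdsNE_chart]

variable [IsManifold 𝓘(ℂ) ω C]

theorem chart_contMDiffAt {x p : C} (hp : p ∈ (chartAt ℂ x).source) :
    ContMDiffAt 𝓘(ℂ) 𝓘(ℂ) ω (chartAt ℂ x) p :=
  contMDiffAt_of_mem_maximalAtlas (IsManifold.chart_mem_maximalAtlas x) hp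

theorem chart_symm_contMDiffAt {x : C} {z : ℂ} (hz : z ∈ (chartAt ℂ x).target) :
    ContMDiffAt 𝓘(ℂ) 𝓘(ℂ) ω (chartAt ℂ x).symm z :=
  contMDiffOn_chart_symm.contMDiffAt ((chartAt ℂ x).open_target.mem_nhds hz)

theorem holAt_iff_analyticAt {f : C → ℂ} {x p : C} (hp : p ∈ (chartAt ℂ x).source) :
    HolAt f p ↔ AnalyticAt ℂ (inChart x f) (chartAt ℂ x p) := by
  set e := chartAt ℂ x
  have hep : e p ∈ e.target := e.map_source hp
  rw [← contDiffAt_omega_iff_analyticAt, ← contMDiffAt_iff_contDiffAt]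
  constructor
  · intro h
    refine ContMDiffAt.comp (e p) (g := f) ?_ (chart_symm_contMDiffAt hep)
    rwa [e.left_inv hp]
  · intro h
    have h2 : HolAt (inChart x f ∘ e) p := ContMDiffAt.comp p h (chart_contMDiffAt hp)
    refine h2.congr_of_eventuallyEq ?_
    filter_upwards [e.open_source.mem_nhds hp] with q hq
    simp only [inChart, Function.comp_apply, e, (chartAt ℂ x).left_inv hq]

theorem HolAt.meroAt {f : C → ℂ} {x : C} (hf : HolAt f x) : MeroAt f x :=
  ((holAt_iff_analyticAt (mem_chart_source ℂ x)).1 hf).meromorphicAt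

theorem HolAt.ordAt_nonneg {f : C → ℂ} {x : C} (hf : HolAt f x) : 0 ≤ ordAt f x :=
  ((holAt_iff_analyticAt (mem_chart_source ℂ x)).1 hf).meromorphicOrderAt_nonneg

theorem MeroAt.eventually_holAt {f : C → ℂ} {x : C} (hf : MeroAt f x) :
    ∀ᶠ p in 𝓝[≠] x, HolAt f p := by
  refine eventually_nhdsNE_chart.1 ?_
  have h1 := MeromorphicAt.eventually_analyticAt hf
  have h2 : ∀ᶠ z in 𝓝[≠] (chartAt ℂ x x), z ∈ (chartAt ℂ x).target :=
    nhdsWithin_le_nhds ((chartAt ℂ x).open_target.mem_nhds (mem_chart_target ℂ x))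
  filter_upwards [h1, h2] with z hz hz'
  rw [holAt_iff_analyticAt ((chartAt ℂ x).map_target hz'), (chartAt ℂ x).right_inv hz']
  exact hz

/-- Removal of singularities. -/
theorem MeroAt.exists_holAt_update {f : C → ℂ} {x : C} (hf : MeroAt f x) (h : 0 ≤ ordAt f x) :
    ∃ c : ℂ, ∀ g : C → ℂ, g x = c → (∀ᶠ p in 𝓝[≠] x, g p = f p) → HolAt g x := by
  obtain ⟨g, hg, hfg⟩ := (MeromorphicAt.meromorphicOrderAt_nonneg_iff hf).1 h
  refine ⟨g (chartAt ℂ x x), fun k hk hkf => ?_⟩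
  rw [holAt_iff_analyticAt (mem_chart_source ℂ x)]
  refine hg.congr ?_
  have h1 : inChart x k =ᶠ[𝓝[≠] (chartAt ℂ x x)] g := (inChart_eventuallyEq hkf).trans hfg
  have h2 := eventually_nhdsWithin_iff.1 h1
  filter_upwards [h2] with z hz
  by_cases hzx : z = chartAt ℂ x x
  · simp [hzx, inChart, hk]
  · exact (hz hzx).symm

theorem coordAt_holAt {x p : C} (hp : p ∈ (chartAt ℂ x).source) : HolAt (coordAt x) p :=
  (chart_contMDiffAt hp).sub contMDiffAt_const

theorem coordAt_ne_zero {x p : C} (hp : p ∈ (chartAt ℂ x).source) (h : p ≠ x) :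
    coordAt x p ≠ 0 := fun h0 =>
  h ((chartAt ℂ x).injOn hp (mem_chart_source ℂ x) (sub_eq_zero.1 h0))

theorem ordAt_coordAt (x : C) : ordAt (coordAt x) x = 1 := by
  have : inChart x (coordAt x) =ᶠ[𝓝[≠] (chartAt ℂ x x)] fun z => z - chartAt ℂ x x := by
    have h2 : ∀ᶠ z in 𝓝[≠] (chartAt ℂ x x), z ∈ (chartAt ℂ x).target :=
      nhdsWithin_le_nhds ((chartAt ℂ x).open_target.mem_nhds (mem_chart_target ℂ x))
    filter_upwards [h2] with z hz
    simp [inChart, coordAt, (chartAt ℂ x).right_inv hz]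
  rw [ordAt, meromorphicOrderAt_congr this, show (1 : WithTop ℤ) = ((1 : ℤ) : WithTop ℤ) from rfl,
    meromorphicOrderAt_eq_int_iff (by fun_prop)]
  exact ⟨fun _ => 1, analyticAt_const, one_ne_zero, by simp⟩

theorem meroAt_coordAt (x : C) : MeroAt (coordAt x) x :=
  (coordAt_holAt (mem_chart_source ℂ x)).meroAt

theorem meroAt_coordAt_zpow (x : C) (n : ℤ) : MeroAt (coordAt x ^ n) x :=
  MeromorphicAt.zpow (meroAt_coordAt x) n

theorem ordAt_coordAt_zpow (x : C) (n : ℤ) : ordAt (coordAt x ^ n) x = n := by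
  have : ordAt (coordAt x ^ n) x = n * ordAt (coordAt x) x :=
    meromorphicOrderAt_zpow (meroAt_coordAt x)
  rw [this, ordAt_coordAt, mul_one]

/-- `f` is meromorphic of order at least `n` at `x`. -/
def OrdGE (f : C → ℂ) (x : C) (n : ℤ) : Prop := MeroAt f x ∧ (n : WithTop ℤ) ≤ ordAt f x

theorem OrdGE.congr {f g : C → ℂ} {x : C} {n : ℤ} (hf : OrdGE f x n) (h : f =ᶠ[𝓝[≠] x] g) :
    OrdGE g x n := ⟨hf.1.congr h, ordAt_congr h ▸ hf.2⟩

theorem OrdGE.mono {f : C → ℂ} {x : C} {n m : ℤ} (hf : OrdGE f x n) (h : m ≤ n) : OrdGE f x m :=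
  ⟨hf.1, le_trans (by exact_mod_cast h) hf.2⟩

theorem OrdGE.add {f g : C → ℂ} {x : C} {n : ℤ} (hf : OrdGE f x n) (hg : OrdGE g x n) :
    OrdGE (f + g) x n :=
  ⟨hf.1.add hg.1, le_trans (le_min hf.2 hg.2) (meromorphicOrderAt_add hf.1 hg.1)⟩

theorem OrdGE.mul {f g : C → ℂ} {x : C} {n m : ℤ} (hf : OrdGE f x n) (hg : OrdGE g x m) :
    OrdGE (f * g) x (n + m) :=
  ⟨hf.1.mul hg.1, by rw [ordAt_mul hf.1 hg.1]; push_cast; exact add_le_add hf.2 hg.2⟩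

theorem HolAt.ordGE {f : C → ℂ} {x : C} (hf : HolAt f x) : OrdGE f x 0 :=
  ⟨hf.meroAt, by exact_mod_cast hf.ordAt_nonneg⟩

theorem OrdGE.const_smul {f : C → ℂ} {x : C} {n : ℤ} (a : ℂ) (hf : OrdGE f x n) :
    OrdGE (a • f) x n := by
  have h : OrdGE (fun _ : C => a) x 0 := HolAt.ordGE contMDiffAt_const
  have := h.mul hf
  rw [zero_add] at this
  exact this

theorem ordGE_zero (x : C) (n : ℤ) : OrdGE (0 : C → ℂ) x n :=
  ⟨meroAt_const 0 x, by
    rw [ordAt_eq_top_iff (f := (0 : C → ℂ)).2 (Eventually.of_forall fun _ => rfl)]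
    exact le_top⟩

theorem ordGE_coordAt_zpow (x : C) (n : ℤ) : OrdGE (coordAt x ^ n) x n :=
  ⟨meroAt_coordAt_zpow x n, (ordAt_coordAt_zpow x n).ge⟩

/-- The leading coefficient. -/
theorem OrdGE.exists_sub {f : C → ℂ} {x : C} {n : ℤ} (hf : OrdGE f x n) :
    ∃ c : ℂ, OrdGE (f - c • coordAt x ^ n) x (n + 1) := by
  have h1 := (ordGE_coordAt_zpow x (-n)).mul hf
  rw [neg_add_cancel] at h1
  -- The coefficient is the limit at `x` of `z⁻ⁿ f`, where `z` is the local coordinate; after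
  -- subtracting it the product vanishes at `x`.
  obtain ⟨c, hc⟩ := tendsto_nhds_of_meromorphicOrderAt_nonneg h1.1 (by exact_mod_cast h1.2)
  refine ⟨c, ?_⟩
  set g : C → ℂ := coordAt x ^ (-n) * f + fun _ => -c with hg
  have hgm : MeroAt g x := h1.1.add (meroAt_const _ x)
  have hg1 : 0 < ordAt g x := by
    rw [ordAt, ← tendsto_zero_iff_meromorphicOrderAt_pos hgm]
    have := hc.add (tendsto_const_nhds (x := -c))
    rw [add_neg_cancel] at this
    exact this
  have hg2 : OrdGE g x 1 := by
    refine ⟨hgm, ?_⟩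
    generalize ordAt g x = o at hg1
    induction o with
    | top => exact le_top
    | coe o =>
      have : (0 : ℤ) < o := by exact_mod_cast hg1
      exact_mod_cast this
  refine ((ordGE_coordAt_zpow x n).mul hg2).congr ?_
  have h2 : ∀ᶠ p in 𝓝[≠] x, p ∈ (chartAt ℂ x).source :=
    nhdsWithin_le_nhds ((chartAt ℂ x).open_source.mem_nhds (mem_chart_source ℂ x))
  filter_upwards [h2, self_mem_nhdsWithin] with p hp hpx
  have h0 : coordAt x p ≠ 0 := coordAt_ne_zero hp hpx
  have : coordAt x p ^ n * coordAt x p ^ (-n) = 1 := by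
    rw [← zpow_add₀ h0]; simp
  simp only [hg, Pi.mul_apply, Pi.pow_apply, Pi.add_apply, Pi.sub_apply, Pi.smul_apply, smul_eq_mul]
  linear_combination (f p) * this

/-- Composition with a biholomorphic map. -/
theorem inChart_comp_biholomorphic {σ : Equiv.Perm C} (h1 : ContMDiff 𝓘(ℂ) 𝓘(ℂ) ω σ)
    (h2 : ContMDiff 𝓘(ℂ) 𝓘(ℂ) ω σ.symm) (f : C → ℂ) (x : C) :
    (MeroAt (f ∘ σ) x ↔ MeroAt f (σ x)) ∧ ordAt (f ∘ σ) x = ordAt f (σ x) := by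
  set e := chartAt ℂ x with he
  set e' := chartAt ℂ (σ x) with he'
  have hx : x ∈ e.source := mem_chart_source ℂ x
  have hx' : σ x ∈ e'.source := mem_chart_source ℂ (σ x)
  set G : ℂ → ℂ := e' ∘ σ ∘ e.symm with hG
  set G' : ℂ → ℂ := e ∘ σ.symm ∘ e'.symm with hG'
  have hGx : G (e x) = e' (σ x) := by simp [G, e.left_inv hx]
  have hGa : AnalyticAt ℂ G (e x) := by
    rw [← contDiffAt_omega_iff_analyticAt, ← contMDiffAt_iff_contDiffAt]
    refine ContMDiffAt.comp (e x) (g := e') ?_ (ContMDiffAt.comp (e x) h1.contMDiffAt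
      (chart_symm_contMDiffAt (e.map_source hx)))
    simp only [Function.comp_apply]
    rw [e.left_inv hx]
    exact chart_contMDiffAt hx'
  have hGa' : AnalyticAt ℂ G' (e' (σ x)) := by
    rw [← contDiffAt_omega_iff_analyticAt, ← contMDiffAt_iff_contDiffAt]
    refine ContMDiffAt.comp _ (g := e) ?_ (ContMDiffAt.comp _ h2.contMDiffAt
      (chart_symm_contMDiffAt (e'.map_source hx')))
    simp only [Function.comp_apply]
    rw [e'.left_inv hx', Equiv.symm_apply_apply]
    exact chart_contMDiffAt hx
  have hnear : ∀ᶠ z in 𝓝 (e x), z ∈ e.target ∧ σ (e.symm z) ∈ e'.source := by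
    refine Filter.Eventually.and (e.open_target.mem_nhds (e.map_source hx)) ?_
    have : ContinuousAt (σ ∘ e.symm) (e x) :=
      h1.continuous.continuousAt.comp (e.continuousAt_symm (e.map_source hx))
    refine this.eventually (e'.open_source.mem_nhds ?_)
    simpa [e.left_inv hx] using hx'
  -- The chart expression of `σ` has an analytic local left inverse, so the chain rule excludes a
  -- zero derivative. Composition then preserves meromorphy and order.
  have hd : deriv G (e x) ≠ 0 := by
    have hcomp : G' ∘ G =ᶠ[𝓝 (e x)] id := by
      filter_upwards [hnear] with z hz
      simp [G, G', e'.left_inv hz.2, e.right_inv hz.1]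
    have h3 := hcomp.deriv_eq
    rw [deriv_comp _ (hGx ▸ hGa'.differentiableAt) hGa.differentiableAt, deriv_id] at h3
    exact fun h0 => by simp [h0] at h3
  have hcong : inChart x (f ∘ σ) =ᶠ[𝓝[≠] (e x)] inChart (σ x) f ∘ G := by
    refine Filter.EventuallyEq.filter_mono ?_ nhdsWithin_le_nhds
    filter_upwards [hnear] with z hz
    simp [inChart, G, ← he, ← he', e'.left_inv hz.2]
  constructor
  · rw [MeroAt, MeromorphicAt.meromorphicAt_congr hcong, meromorphicAt_comp_iff_of_deriv_ne_zero hGa hd, hGx]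
    rfl
  · rw [ordAt, meromorphicOrderAt_congr hcong, meromorphicOrderAt_comp_of_deriv_ne_zero hGa hd, hGx]
    rfl

theorem OrdGE.comp_biholomorphic {σ : Equiv.Perm C} (h1 : ContMDiff 𝓘(ℂ) 𝓘(ℂ) ω σ)
    (h2 : ContMDiff 𝓘(ℂ) 𝓘(ℂ) ω σ.symm) {f : C → ℂ} {x : C} {n : ℤ} (hf : OrdGE f (σ x) n) :
    OrdGE (f ∘ σ) x n := by
  obtain ⟨h3, h4⟩ := inChart_comp_biholomorphic h1 h2 f x
  exact ⟨h3.2 hf.1, h4 ▸ hf.2⟩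

end Meromorphic

/-! ### Adeles and the first cohomology -/

section Adeles

open Filter Topology

variable {C : Type u} [TopologicalSpace C]

/-- By compactness finitely many such neighbourhoods cover `C`, and only their centres can be
exceptional. -/
theorem finite_not_of_eventually_nhdsNE [CompactSpace C] {P : C → Prop}
    (h : ∀ x, ∀ᶠ p in 𝓝[≠] x, P p) : {p | ¬ P p}.Finite := by
  have h' : ∀ x ∈ (Set.univ : Set C), {p | p ≠ x → P p} ∈ 𝓝 x := fun x _ =>
    eventually_nhdsWithin_iff.1 (h x)
  obtain ⟨t, -, ht⟩ := isCompact_univ.elim_nhds_subcover _ h'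
  refine t.finite_toSet.subset fun p hp => ?_
  obtain ⟨x, hxt, hx⟩ := Set.mem_iUnion₂.1 (ht (Set.mem_univ p))
  by_cases hpx : p = x
  · exact hpx ▸ hxt
  · exact absurd (hx hpx) hp

theorem exists_pointedCover {Q : C → C → Prop} (h : ∀ x, ∀ᶠ p in 𝓝 x, Q x p) :
    ∃ U : PointedCover C, ∀ x, ∀ p ∈ U.1 x, Q x p := by
  choose V hV hVo hxV using fun x => mem_nhds_iff.1 (h x)
  exact ⟨⟨fun x => ⟨V x, hVo x⟩, hxV⟩, fun x p hp => hV x hp⟩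

theorem eventually_mem_imp_eq [T1Space C] {S : Set C} (hS : S.Finite) (x : C) :
    ∀ᶠ p in 𝓝 x, p ∈ S → p = x := by
  filter_upwards [(hS.subset (Set.sdiff_subset (t := {x}))).isClosed.isOpen_compl.mem_nhds
    (by simp : x ∈ (S \ {x})ᶜ)] with p hp hpS
  by_contra hne
  exact hp ⟨hpS, hne⟩

variable [ChartedSpace ℂ C]

theorem nhdsNE_neBot (P : C) : (𝓝[≠] P).NeBot := by
  have := (eventually_nhdsNE_chart (x := P) (Q := fun _ => False)).not.1 (by
    simpa [Filter.neBot_iff] using (inferInstance : (𝓝[≠] (chartAt ℂ P P)).NeBot).ne)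
  exact ⟨fun hb => this (by rw [hb]; exact Filter.eventually_bot)⟩

/-- The coboundary map from 0-cochains to 1-cochains. -/
def cechδ : (C → C → ℂ) →ₗ[ℂ] (C → C → C → ℂ) where
  toFun u x y p := u y p - u x p
  map_add' u v := by ext x y p; simp only [Pi.add_apply]; ring
  map_smul' a u := by ext x y p; simp only [Pi.smul_apply, smul_eq_mul, RingHom.id_apply]; ring

theorem cechδ_apply (u : C → C → ℂ) (x y p : C) : cechδ u x y p = u y p - u x p := rfl

/-- `f` is a meromorphic function. -/
def IsMero (f : C → ℂ) : Prop := ∀ x, MeroAt f x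

variable [IsManifold 𝓘(ℂ) ω C]

/-- The families of germs `u x` of meromorphic functions, almost all of which are holomorphic. -/
def adeles (C : Type u) [TopologicalSpace C] [ChartedSpace ℂ C] [IsManifold 𝓘(ℂ) ω C] :
    Submodule ℂ (C → C → ℂ) where
  carrier := {u | (∀ x, MeroAt (u x) x) ∧ {x | ¬ HolAt (u x) x}.Finite}
  zero_mem' := ⟨fun x => meroAt_const 0 x, by
    have : {x : C | ¬ HolAt ((0 : C → C → ℂ) x) x} = ∅ := by
      refine Set.eq_empty_of_forall_notMem fun x hx => hx ?_
      exact (contMDiffAt_const : HolAt (fun _ : C => (0 : ℂ)) x)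
    rw [this]; exact Set.finite_empty⟩
  add_mem' := fun {u v} hu hv => ⟨fun x => (hu.1 x).add (hv.1 x),
    (hu.2.union hv.2).subset fun x hx => by
      by_contra h
      simp only [Set.mem_union, Set.mem_ofPred_eq, not_or, not_not] at h
      exact hx (h.1.add h.2)⟩
  smul_mem' := fun a u hu => ⟨fun x => (hu.1 x).const_smul a, hu.2.subset fun x hx h => hx
    (contMDiffAt_const.mul h)⟩

/-- The adeles with poles bounded by the divisor `D`. -/
def adelesGE (D : C → ℤ) : Submodule ℂ (C → C → ℂ) where
  carrier := {u | u ∈ adeles C ∧ ∀ x, OrdGE (u x) x (-D x)}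
  zero_mem' := ⟨zero_mem _, fun x => ordGE_zero x _⟩
  add_mem' := fun hu hv => ⟨add_mem hu.1 hv.1, fun x => (hu.2 x).add (hv.2 x)⟩
  smul_mem' := fun a _ hu => ⟨Submodule.smul_mem _ a hu.1, fun x => (hu.2 x).const_smul a⟩

/-- The meromorphic functions with poles bounded by the divisor `D`. -/
def meroGE (D : C → ℤ) : Submodule ℂ (C → ℂ) where
  carrier := {f | ∀ x, OrdGE f x (-D x)}
  zero_mem' := fun x => ordGE_zero x _
  add_mem' := fun hu hv x => (hu x).add (hv x)
  smul_mem' := fun a _ hu x => (hu x).const_smul a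

variable [CompactSpace C]

theorem IsMero.finite_not_holAt {f : C → ℂ} (hf : IsMero f) : {x | ¬ HolAt f x}.Finite :=
  finite_not_of_eventually_nhdsNE fun x => (hf x).eventually_holAt

theorem IsMero.const_mem_adeles {f : C → ℂ} (hf : IsMero f) : (fun _ => f) ∈ adeles C :=
  ⟨hf, hf.finite_not_holAt⟩

variable [T2Space C]

/-- Shrink `U x` until `x` is the only possible pole of `u x` in it and the only possible bad index
in it. An overlap of two different sets then contains no singularity of either germ. -/
theorem cechδ_mem_cocycles {u : C → C → ℂ} (hu : u ∈ adeles C) : cechδ u ∈ cechCocycles C := by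
  obtain ⟨h1, h2⟩ := hu
  obtain ⟨U, hU⟩ := exists_pointedCover (Q := fun x p => (p ≠ x → HolAt (u x) p) ∧
    (p ∈ {x | ¬ HolAt (u x) x} → p = x)) fun x =>
    (eventually_nhdsWithin_iff.1 (h1 x).eventually_holAt).and (eventually_mem_imp_eq h2 x)
  refine ⟨U, fun x y p hp => ?_, fun x y z p _ => by simp only [cechδ_apply]; ring⟩
  by_cases hxy : x = y
  · subst hxy
    have : cechδ u x x = fun _ => 0 := by ext; simp [cechδ_apply]
    rw [this]
    exact contMDiffWithinAt_const
  · have key : ∀ x y, x ≠ y → p ∈ U.1 x → p ∈ U.1 y → HolAt (u x) p := by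
      intro x y hxy hx hy
      by_cases hpx : p = x
      · by_contra hh
        subst hpx
        exact hxy ((hU y p hy).2 hh)
      · exact (hU x p hx).1 hpx
    exact ((key y x (Ne.symm hxy) hp.2 hp.1).sub (key x y hxy hp.1 hp.2)).contMDiffWithinAt

/-- All singularities are removable, and the corrected germs form a holomorphic 0-cochain with the
same differences on small overlaps. -/
theorem cechδ_mem_coboundaries {u : C → C → ℂ} (hu : u ∈ adelesGE (0 : C → ℤ)) :
    cechδ u ∈ cechCoboundaries C := by
  classical
  obtain ⟨⟨h1, h2⟩, h3⟩ := hu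
  choose c hc using fun x => (h1 x).exists_holAt_update (by simpa using (h3 x).2)
  set S := {x | ¬ HolAt (u x) x} with hS
  -- Values are changed only at the finitely many bad indices: a good `x` may lie in another set of
  -- the cover, where `r x x` must still equal `u x x`.
  set r : C → C → ℂ := fun x => if x ∈ S then Function.update (u x) x (c x) else u x with hr
  have hrne : ∀ x p, p ≠ x → r x p = u x p := by
    intro x p hp
    by_cases hx : x ∈ S <;> simp [hr, hx, hp]
  have hrS : ∀ x, x ∉ S → r x = u x := fun x hx => by simp [hr, hx]
  have hrx : ∀ x, HolAt (r x) x := by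
    intro x
    by_cases hx : x ∈ S
    · refine hc x _ (by simp [hr, hx]) ?_
      filter_upwards [self_mem_nhdsWithin] with p hp using hrne x p hp
    · rw [hrS x hx]; simpa [hS] using hx
  obtain ⟨U, hU⟩ := exists_pointedCover (Q := fun x p => (p ≠ x → HolAt (r x) p) ∧
    (p ∈ S → p = x)) fun x =>
    (eventually_nhdsWithin_iff.1 (hrx x).meroAt.eventually_holAt).and (eventually_mem_imp_eq h2 x)
  refine ⟨U, r, fun x p hp => ?_, fun x y p hp => ?_⟩
  · by_cases hpx : p = x
    · exact hpx ▸ (hrx x).contMDiffWithinAt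
    · exact ((hU x p hp).1 hpx).contMDiffWithinAt
  · by_cases hxy : x = y
    · subst hxy; simp [cechδ_apply]
    · have key : ∀ x y, x ≠ y → p ∈ U.1 x → p ∈ U.1 y → r x p = u x p := by
        intro x y hxy hx hy
        by_cases hpx : p = x
        · by_cases hpS : x ∈ S
          · exact absurd ((hU y p hy).2 (hpx ▸ hpS)) (fun h => hxy (hpx ▸ h))
          · rw [hrS x hpS]
        · exact hrne x p hpx
      rw [key x y hxy hp.1 hp.2, key y x (Ne.symm hxy) hp.2 hp.1, cechδ_apply]

/-- The differences `u x - g x` agree on overlaps, so they glue to a global meromorphic function.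
Its value at `p` can be read off from the index `p` itself. -/
theorem exists_mero_of_cechδ_mem_coboundaries {u : C → C → ℂ} (hu : u ∈ adeles C)
    (h : cechδ u ∈ cechCoboundaries C) :
    ∃ f : C → ℂ, IsMero f ∧ ∀ x, HolAt (u x - f) x := by
  obtain ⟨U, g, hg, hgu⟩ := h
  have hfx : ∀ x, ∀ p ∈ U.1 x, (u p p - g p p) = u x p - g x p := by
    intro x p hp
    have := hgu x p p ⟨hp, U.2 p⟩
    rw [cechδ_apply] at this
    linear_combination this
  have hgx : ∀ x, HolAt (g x) x := fun x =>
    (hg x).contMDiffAt ((U.1 x).isOpen.mem_nhds (U.2 x))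
  have hev : ∀ x, ∀ᶠ p in 𝓝 x, p ∈ U.1 x := fun x => (U.1 x).isOpen.mem_nhds (U.2 x)
  refine ⟨fun p => u p p - g p p, fun x => ?_, fun x => ?_⟩
  · refine ((hu.1 x).add ((hgx x).meroAt.const_smul (-1))).congr ?_
    refine Filter.Eventually.filter_mono nhdsWithin_le_nhds ?_
    filter_upwards [hev x] with p hp
    rw [hfx x p hp]
    simp [sub_eq_add_neg]
  · refine (hgx x).congr_of_eventuallyEq ?_
    filter_upwards [hev x] with p hp
    simp only [Pi.sub_apply]
    rw [hfx x p hp]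
    ring

/-- The connecting map from adeles to `H¹(C, 𝒪)`. -/
def adelesToH1 (C : Type u) [TopologicalSpace C] [ChartedSpace ℂ C] [IsManifold 𝓘(ℂ) ω C]
    [CompactSpace C] [T2Space C] : adeles C →ₗ[ℂ] CechH1 C :=
  (Submodule.mkQ _).comp ((cechδ.comp (adeles C).subtype).codRestrict _
    fun u => cechδ_mem_cocycles u.2)

theorem adelesToH1_eq_mk (u : adeles C) :
    adelesToH1 C u = Submodule.Quotient.mk ⟨cechδ u.1, cechδ_mem_cocycles u.2⟩ := rfl

theorem adelesToH1_eq_zero_iff {u : adeles C} :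
    adelesToH1 C u = 0 ↔ cechδ u.1 ∈ cechCoboundaries C := by
  rw [adelesToH1_eq_mk, Submodule.Quotient.mk_eq_zero]; rfl

theorem MeroAt.polynomial_eval {f : C → ℂ} {x : C} (hf : MeroAt f x) (q : Polynomial ℂ) :
    MeroAt (fun p => q.eval (f p)) x := by
  induction q using Polynomial.induction_on' with
  | add a b ha hb =>
    simp only [Polynomial.eval_add]
    exact ha.add hb
  | monomial n a =>
    simp only [Polynomial.eval_monomial]
    exact (meroAt_const a x).mul (MeromorphicAt.pow hf n)

theorem tendsto_norm_coordAt_inv (P : C) :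
    Tendsto (fun p => ‖(coordAt P p)⁻¹‖) (𝓝[≠] P) atTop := by
  have h : ordAt (coordAt P)⁻¹ P < 0 := by
    rw [ordAt_inv, ordAt_coordAt]
    exact WithTop.coe_lt_coe.2 (by norm_num : (-1 : ℤ) < 0)
  exact tendsto_norm_atTop_iff_cobounded.2 ((meroAt_coordAt P).inv.tendsto_cobounded_iff.2 h)

/-- Principal parts at `P` form an infinite-dimensional space, so some nonzero one has zero class in
the finite-dimensional `H¹`. It is then the principal part of a global function. -/
theorem exists_mero_single_pole [FiniteDimensional ℂ (CechH1 C)] (P : C) :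
    ∃ f : C → ℂ, IsMero f ∧ ordAt f P < 0 ∧ ∀ x, x ≠ P → HolAt f x := by
  classical
  -- The factor `X` removes the constant term, so every nonzero `q` gives a genuine pole at `P`.
  let T : Polynomial ℂ →ₗ[ℂ] (C → C → ℂ) :=
    { toFun := fun q x p => if x = P then (q * Polynomial.X).eval (coordAt P p)⁻¹ else 0
      map_add' := fun q r => by
        ext x p; by_cases h : x = P <;> simp [h, add_mul]
      map_smul' := fun a q => by
        ext x p; by_cases h : x = P <;> simp [h] }
  have hTP : ∀ q, T q P = fun p => (q * Polynomial.X).eval (coordAt P p)⁻¹ := fun q => by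
    ext p; simp [T]
  have hTx : ∀ q x, x ≠ P → T q x = fun _ => 0 := fun q x hx => by
    ext p; simp [T, hx]
  have hTm : ∀ q, T q ∈ adeles C := by
    refine fun q => ⟨fun x => ?_, (Set.finite_singleton P).subset fun x hx => ?_⟩
    · by_cases hx : x = P
      · subst hx
        rw [hTP]
        exact MeroAt.polynomial_eval (meroAt_coordAt x).inv _
      · rw [hTx q x hx]; exact meroAt_const 0 x
    · by_contra hxP
      refine hx ?_
      rw [hTx q x hxP]
      exact contMDiffAt_const
  let T' := (adelesToH1 C).comp (T.codRestrict _ hTm)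
  have hni : ¬ Function.Injective T' := fun hi =>
    Polynomial.not_finite (R := ℂ) (Module.Finite.of_injective T' hi)
  rw [← LinearMap.ker_eq_bot, Submodule.eq_bot_iff] at hni
  push Not at hni
  obtain ⟨q, hq, hq0⟩ := hni
  have hq1 : cechδ (T q) ∈ cechCoboundaries C := adelesToH1_eq_zero_iff.1 hq
  obtain ⟨f, hf, hfx⟩ := exists_mero_of_cechδ_mem_coboundaries (hTm q) hq1
  refine ⟨f, hf, ?_, fun x hx => ?_⟩
  · by_contra hlt
    rw [not_lt] at hlt
    have h1 : OrdGE f P 0 := ⟨hf P, by exact_mod_cast hlt⟩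
    have h2 : OrdGE (T q P) P 0 := by
      have := (hfx P).ordGE.add h1
      rwa [sub_add_cancel] at this
    have h3 : Tendsto (T q P) (𝓝[≠] P) (Bornology.cobounded ℂ) := by
      rw [← tendsto_norm_atTop_iff_cobounded, hTP]
      refine Polynomial.tendsto_norm_atTop _ ?_ (tendsto_norm_coordAt_inv P)
      rw [Polynomial.degree_mul, Polynomial.degree_X, Polynomial.degree_eq_natDegree hq0]
      exact_mod_cast Nat.succ_pos _
    rw [h2.1.tendsto_cobounded_iff] at h3
    exact absurd h3 (not_lt.2 (by exact_mod_cast h2.2))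
  · have := hfx x
    rw [hTx q x hx] at this
    refine this.neg.congr_of_eventuallyEq (Eventually.of_forall fun p => ?_)
    simp

variable [ConnectedSpace C]

/-- Identity theorem: the points near which `f` vanishes identically form a clopen set, which misses
`P`. -/
theorem IsMero.eventually_ne_zero {f : C → ℂ} (hf : IsMero f) {P : C} (hP : ordAt f P ≠ ⊤)
    (x : C) : ∀ᶠ p in 𝓝[≠] x, f p ≠ 0 := by
  rw [← (hf x).ordAt_ne_top_iff]
  have hclopen : IsClopen {x : C | ordAt f x = ⊤} := by
    constructor
    · rw [← isOpen_compl_iff, isOpen_iff_mem_nhds]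
      intro y hy
      have h1 := (hf y).ordAt_ne_top_iff.1 hy
      have h2 := eventually_nhdsWithin_iff.1 (h1.and (hf y).eventually_holAt)
      filter_upwards [h2] with z hz
      by_cases hzy : z = y
      · exact hzy ▸ hy
      · have := hz hzy
        refine (hf z).ordAt_ne_top_iff.2 (Eventually.filter_mono nhdsWithin_le_nhds ?_)
        exact this.2.continuousAt.eventually_ne this.1
    · rw [isOpen_iff_mem_nhds]
      intro y hy
      obtain ⟨V, hV, hVo, hyV⟩ := mem_nhds_iff.1
        (eventually_nhdsWithin_iff.1 (ordAt_eq_top_iff.1 hy))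
      filter_upwards [hVo.mem_nhds hyV] with z hz
      refine ordAt_eq_top_iff.2 ?_
      by_cases hzy : z = y
      · subst hzy; exact ordAt_eq_top_iff.1 hy
      · filter_upwards [nhdsWithin_le_nhds (hVo.mem_nhds hz), nhdsWithin_le_nhds
          (isOpen_ne.mem_nhds hzy)] with p hp hpy using hV hp hpy
  rcases isClopen_iff.1 hclopen with h | h
  · exact fun hx => (h ▸ hx : x ∈ (∅ : Set C))
  · exact absurd (h ▸ Set.mem_univ P : P ∈ {x : C | ordAt f x = ⊤}) hP

/-- The poles of `f` are harmless: after refinement each lies in only one set of the cover, and a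
cocycle vanishes on the diagonal. -/
theorem IsMero.mul_mem_cocycles {f : C → ℂ} (hf : IsMero f) {c : C → C → C → ℂ}
    (hc : c ∈ cechCocycles C) : (fun x y p => f p * c x y p) ∈ cechCocycles C := by
  obtain ⟨U, hU⟩ := hc
  obtain ⟨V, hV⟩ := exists_pointedCover (eventually_mem_imp_eq hf.finite_not_holAt)
  refine ⟨U.inf V, fun x y p hp => ?_, fun x y z p hp => ?_⟩
  · by_cases hxy : x = y
    · subst hxy
      refine (contMDiffOn_const (c := (0 : ℂ))).congr (fun q hq => ?_) p hp
      have := hU.2 x x x q ⟨⟨hq.1.1, hq.1.1⟩, hq.1.1⟩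
      have h0 : c x x q = 0 := by linear_combination this
      simp [h0]
    · have h1 : HolAt f p := by
        by_contra h
        exact hxy ((hV x p hp.1.2 h).symm.trans (hV y p hp.2.2 h))
      exact h1.contMDiffWithinAt.mul ((hU.1 x y).mono (fun q hq => ⟨hq.1.1, hq.2.1⟩) p hp)
  · have := hU.2 x y z p ⟨⟨hp.1.1.1, hp.1.2.1⟩, hp.2.1⟩
    linear_combination f p * this

/-- Let `f` be nonconstant and multiply the cocycle `c` by all polynomials in `f`. The cokernel is
finite-dimensional, so some nonzero `F = q(f)` makes `F c` the coboundary of an adele `u` up to a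
holomorphic coboundary `δh`. Then `F⁻¹ (u - h)` is an adele mapping to `c`, once the zeros of `F`
are kept away from overlaps of different sets. -/
theorem adelesToH1_surjective [FiniteDimensional ℂ (CechH1 C)] :
    Function.Surjective (adelesToH1 C) := by
  obtain ⟨P⟩ := (inferInstance : Nonempty C)
  obtain ⟨f, hf, hfP, -⟩ := exists_mero_single_pole P
  rw [← LinearMap.range_eq_top, Submodule.eq_top_iff']
  intro j
  obtain ⟨⟨c, hc⟩, rfl⟩ := Submodule.Quotient.mk_surjective _ j
  have hqf : ∀ q : Polynomial ℂ, IsMero fun p => q.eval (f p) := fun q x => (hf x).polynomial_eval q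
  let T : Polynomial ℂ →ₗ[ℂ] cechCocycles C :=
    { toFun := fun q => ⟨fun x y p => q.eval (f p) * c x y p, (hqf q).mul_mem_cocycles hc⟩
      map_add' := fun q r => by ext x y p; simp [add_mul]
      map_smul' := fun a q => by ext x y p; simp [mul_assoc] }
  let T' := (LinearMap.range (adelesToH1 C)).mkQ.comp ((Submodule.mkQ _).comp T)
  have hni : ¬ Function.Injective T' := fun hi =>
    Polynomial.not_finite (R := ℂ) (Module.Finite.of_injective T' hi)
  rw [← LinearMap.ker_eq_bot, Submodule.eq_bot_iff] at hni
  push Not at hni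
  obtain ⟨q, hq, hq0⟩ := hni
  obtain ⟨u, hu⟩ := (Submodule.Quotient.mk_eq_zero _).1 hq
  rw [adelesToH1_eq_mk] at hu
  replace hu := (Submodule.Quotient.eq _).1 hu
  obtain ⟨U, h, hh, hhu⟩ := hu
  obtain ⟨V, hV⟩ := hc
  set F : C → ℂ := fun p => q.eval (f p) with hF
  have hFP : ordAt F P ≠ ⊤ := by
    intro htop
    rw [ordAt_eq_top_iff] at htop
    have h1 := (hf P).tendsto_cobounded_iff.2 hfP
    have h2 : {z : ℂ | q.eval z = 0}.Finite := by
      refine (q.roots.toFinset.finite_toSet).subset fun z hz => ?_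
      simpa [hq0] using hz
    have h3 : ∀ᶠ p in 𝓝[≠] P, q.eval (f p) ≠ 0 :=
      h1.eventually (Bornology.isBounded_def.1 h2.isBounded)
    have := nhdsNE_neBot P
    obtain ⟨p, hp1, hp2⟩ := (htop.and h3).exists
    exact hp2 hp1
  have hFne := (hqf q).eventually_ne_zero hFP
  have hhx : ∀ x, HolAt (h x) x := fun x =>
    (hh x).contMDiffAt ((U.1 x).isOpen.mem_nhds (U.2 x))
  have hFinv : IsMero F⁻¹ := fun x => (hqf q x).inv
  set w : C → C → ℂ := fun x => F⁻¹ * (u.1 x - h x) with hw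
  have hwm : w ∈ adeles C := by
    refine ⟨fun x => (hFinv x).mul ?_, (u.2.2.union hFinv.finite_not_holAt).subset
      fun x hx => ?_⟩
    · rw [sub_eq_add_neg]
      refine (u.2.1 x).add ?_
      have := (hhx x).meroAt.const_smul (-1)
      rwa [neg_one_smul] at this
    · by_contra hcon
      simp only [Set.mem_union, Set.mem_ofPred_eq, not_or, not_not] at hcon
      exact hx (hcon.2.mul (hcon.1.sub (hhx x)))
  obtain ⟨W, hW⟩ := exists_pointedCover
    (eventually_mem_imp_eq (finite_not_of_eventually_nhdsNE hFne))
  refine ⟨⟨w, hwm⟩, ?_⟩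
  rw [adelesToH1_eq_mk, Submodule.Quotient.eq]
  refine ⟨(U.inf V).inf W, 0, fun x => contMDiffOn_const, fun x y p hp => ?_⟩
  have hcp : cechδ u.1 x y p - F p * c x y p = h y p - h x p := hhu x y p ⟨hp.1.1.1, hp.2.1.1⟩
  change cechδ w x y p - c x y p = 0 - 0
  by_cases hxy : x = y
  · subst hxy
    have := hV.2 x x x p ⟨⟨hp.1.1.2, hp.1.1.2⟩, hp.1.1.2⟩
    rw [cechδ_apply]
    linear_combination -this
  · have hFp : F p ≠ 0 := by
      by_contra h0
      exact hxy ((hW x p hp.1.2 (not_not.2 h0)).symm.trans (hW y p hp.2.2 (not_not.2 h0)))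
    rw [cechδ_apply] at hcp ⊢
    simp only [hw, Pi.mul_apply, Pi.inv_apply, Pi.sub_apply]
    field_simp
    linear_combination hcp

end Adeles

/-! ### Traces in exact sequences and subquotients -/

section LinearAlgebra

variable {K : Type*} [Field K]
  {A B E F : Type*} [AddCommGroup A] [Module K A] [AddCommGroup B] [Module K B]
  [AddCommGroup E] [Module K E] [AddCommGroup F] [Module K F]

/-- A retraction `r` and a section `s` with `i r + s p = id` split `b` as `i a r + b s p`; cyclicity
of the trace evaluates both terms. -/
theorem LinearMap.trace_eq_add_of_exact [FiniteDimensional K A] [FiniteDimensional K B]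
    [FiniteDimensional K E] {i : A →ₗ[K] B} {p : B →ₗ[K] E} (hi : Function.Injective i)
    (hp : Function.Surjective p) (hex : Function.Exact i p) {a : A →ₗ[K] A} {b : B →ₗ[K] B}
    {e : E →ₗ[K] E} (hia : b ∘ₗ i = i ∘ₗ a) (hpb : p ∘ₗ b = e ∘ₗ p) :
    LinearMap.trace K B b = LinearMap.trace K A a + LinearMap.trace K E e := by
  obtain ⟨r, hr⟩ := i.exists_leftInverse_of_injective (LinearMap.ker_eq_bot.2 hi)
  obtain ⟨s₀, hs₀⟩ := p.exists_rightInverse_of_surjective (LinearMap.range_eq_top.2 hp)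
  have hri : ∀ x, r (i x) = x := fun x => LinearMap.congr_fun hr x
  have hps₀ : ∀ x, p (s₀ x) = x := fun x => LinearMap.congr_fun hs₀ x
  have hpi : ∀ x, p (i x) = 0 := fun x => (hex (i x)).2 ⟨x, rfl⟩
  set s : E →ₗ[K] B := s₀ - i ∘ₗ r ∘ₗ s₀ with hs
  have hps : p ∘ₗ s = LinearMap.id := by
    ext x; simp [hs, hps₀, hpi]
  have hid : i ∘ₗ r + s ∘ₗ p = LinearMap.id := by
    ext x
    obtain ⟨y, hy⟩ := (hex (x - s₀ (p x))).1 (by simp [hps₀])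
    have hx : x = i y + s₀ (p x) := by rw [hy]; abel
    have : i (r x) = i y + i (r (s₀ (p x))) := by
      conv_lhs => rw [hx]
      simp [hri]
    simp only [hs, LinearMap.add_apply, LinearMap.comp_apply, LinearMap.sub_apply, this,
      LinearMap.id_apply]
    conv_rhs => rw [hx]
    abel
  have hb : b = (i ∘ₗ a) ∘ₗ r + (b ∘ₗ s) ∘ₗ p := by
    rw [← hia, LinearMap.comp_assoc, LinearMap.comp_assoc, ← LinearMap.comp_add, hid,
      LinearMap.comp_id]
  have h1 : LinearMap.trace K B ((i ∘ₗ a) ∘ₗ r) = LinearMap.trace K A a := by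
    rw [LinearMap.trace_comp_comm', ← LinearMap.comp_assoc, hr, LinearMap.id_comp]
  have h2 : LinearMap.trace K B ((b ∘ₗ s) ∘ₗ p) = LinearMap.trace K E e := by
    rw [LinearMap.trace_comp_comm', ← LinearMap.comp_assoc, hpb, LinearMap.comp_assoc, hps,
      LinearMap.comp_id]
  rw [hb, map_add, h1, h2]

/-- Cut the sequence at the range of `f` into two short exact ones; the trace on that range cancels.
-/
theorem LinearMap.trace_add_eq_of_exact [FiniteDimensional K A] [FiniteDimensional K B]
    [FiniteDimensional K E] [FiniteDimensional K F] {i : A →ₗ[K] B} {f : B →ₗ[K] E}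
    {p : E →ₗ[K] F} (hi : Function.Injective i)
    (hp : Function.Surjective p) (hif : Function.Exact i f) (hfp : Function.Exact f p)
    {a : A →ₗ[K] A} {b : B →ₗ[K] B} {e : E →ₗ[K] E} {t : F →ₗ[K] F}
    (hia : b ∘ₗ i = i ∘ₗ a) (hfb : f ∘ₗ b = e ∘ₗ f) (hpe : p ∘ₗ e = t ∘ₗ p) :
    LinearMap.trace K B b + LinearMap.trace K F t =
      LinearMap.trace K A a + LinearMap.trace K E e := by
  have hmap : ∀ x ∈ LinearMap.range f, e x ∈ LinearMap.range f := by
    rintro _ ⟨x, rfl⟩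
    exact ⟨b x, LinearMap.congr_fun hfb x⟩
  have h1 := LinearMap.trace_eq_add_of_exact (p := f.rangeRestrict) (e := e.restrict hmap) hi
    f.surjective_rangeRestrict (fun x => by
      rw [← hif x, Subtype.ext_iff]; rfl) hia
    (by ext x; exact LinearMap.congr_fun hfb x)
  have h2 := LinearMap.trace_eq_add_of_exact (i := (LinearMap.range f).subtype) (p := p)
    (a := e.restrict hmap) (b := e) (e := t) (Submodule.injective_subtype _) hp
    (fun x => by rw [hfp x]; simp) (by ext x; rfl) hpe
  rw [h1, h2]; ring

variable {M M' M'' : Type*} [AddCommGroup M] [Module K M] [AddCommGroup M'] [Module K M']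
  [AddCommGroup M''] [Module K M'']

/-- The subquotient `A / (A ∩ B)` of `M`. -/
abbrev SubQuot (A B : Submodule K M) : Type _ := A ⧸ B.comap A.subtype

namespace SubQuot

variable {A B : Submodule K M} {A' B' : Submodule K M'} {A'' B'' : Submodule K M''}

/-- The class of an element of `A` in `A / (A ∩ B)`. -/
def mk (a : M) (ha : a ∈ A) : SubQuot A B := Submodule.Quotient.mk ⟨a, ha⟩

theorem exists_mk (j : SubQuot A B) : ∃ a, ∃ ha : a ∈ A, j = mk a ha := by
  obtain ⟨⟨a, ha⟩, rfl⟩ := Submodule.Quotient.mk_surjective _ j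
  exact ⟨a, ha, rfl⟩

theorem mk_eq_mk {a b : M} {ha : a ∈ A} {hb : b ∈ A} :
    (mk a ha : SubQuot A B) = mk b hb ↔ a - b ∈ B := by
  rw [mk, mk, Submodule.Quotient.eq]; rfl

theorem mk_eq_zero {a : M} {ha : a ∈ A} : (mk a ha : SubQuot A B) = 0 ↔ a ∈ B := by
  rw [mk, Submodule.Quotient.mk_eq_zero]; rfl

/-- The map on subquotients induced by a linear map. -/
def map (T : M →ₗ[K] M') (hA : ∀ a ∈ A, T a ∈ A') (hB : ∀ a ∈ A, a ∈ B → T a ∈ B') :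
    SubQuot A B →ₗ[K] SubQuot A' B' :=
  Submodule.mapQ _ _ (T.restrict hA) fun a ha => hB a.1 a.2 ha

theorem hom_ext {f g : SubQuot A B →ₗ[K] M''} (h : ∀ a ha, f (mk a ha) = g (mk a ha)) : f = g := by
  ext ⟨a, ha⟩; exact h a ha

variable {T : M →ₗ[K] M'} {hA : ∀ a ∈ A, T a ∈ A'} {hB : ∀ a ∈ A, a ∈ B → T a ∈ B'}

theorem map_injective (h : ∀ a ∈ A, T a ∈ B' → a ∈ B) : Function.Injective (map T hA hB) := by
  rw [injective_iff_map_eq_zero]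
  intro j hj
  obtain ⟨a, ha, rfl⟩ := exists_mk j
  exact mk_eq_zero.2 (h a ha (mk_eq_zero.1 hj))

theorem map_exact {T' : M' →ₗ[K] M''} {hA' : ∀ a ∈ A', T' a ∈ A''}
    {hB' : ∀ a ∈ A', a ∈ B' → T' a ∈ B''} (h1 : ∀ a ∈ A, T' (T a) ∈ B'')
    (h2 : ∀ a' ∈ A', T' a' ∈ B'' → ∃ a ∈ A, T a - a' ∈ B') :
    Function.Exact (map T hA hB) (map T' hA' hB') := by
  intro j
  obtain ⟨a', ha', rfl⟩ := exists_mk j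
  constructor
  · intro h
    obtain ⟨a, ha, h⟩ := h2 a' ha' (mk_eq_zero.1 h)
    exact ⟨mk a ha, mk_eq_mk.2 h⟩
  · rintro ⟨i, hi⟩
    obtain ⟨a, ha, rfl⟩ := exists_mk i
    rw [← hi]
    exact mk_eq_zero.2 (h1 a ha)

theorem finiteDimensional_of_le (hBA : B ≤ A) {W : Submodule K M} [FiniteDimensional K W]
    (h : A ≤ B ⊔ W) : FiniteDimensional K (SubQuot A B) := by
  have : FiniteDimensional K ↥(W ⊓ A) := Submodule.finiteDimensional_inf_left _ _
  refine Module.Finite.of_surjective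
    ((Submodule.mkQ _).comp (Submodule.inclusion (inf_le_right : W ⊓ A ≤ A))) fun j => ?_
  obtain ⟨a, ha, rfl⟩ := exists_mk j
  obtain ⟨b, hb, w, hw, rfl⟩ := Submodule.mem_sup.1 (h ha)
  refine ⟨⟨w, hw, (Submodule.add_mem_iff_right _ (hBA hb)).1 ha⟩, ?_⟩
  refine mk_eq_mk.2 ?_
  simpa using neg_mem hb

end SubQuot

end LinearAlgebra

/-! ### Functoriality of the first cohomology -/

section Pullback

open SubQuot

variable {C C' : Type u} [TopologicalSpace C] [ChartedSpace ℂ C] [TopologicalSpace C']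
  [ChartedSpace ℂ C']

/-- Pullback of 1-cochains. -/
def cochainPullback (q : C → C') : (C' → C' → C' → ℂ) →ₗ[ℂ] (C → C → C → ℂ) where
  toFun c x y p := c (q x) (q y) (q p)
  map_add' _ _ := rfl
  map_smul' _ _ := rfl

variable {q : C → C'} (hq : ContMDiff 𝓘(ℂ) 𝓘(ℂ) ω q)
include hq

/-- The preimage of a cover. -/
def PointedCover.preimage (U : PointedCover C') : PointedCover C :=
  ⟨fun x => ⟨q ⁻¹' U.1 (q x), (U.1 (q x)).isOpen.preimage hq.continuous⟩, fun x => U.2 (q x)⟩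

theorem cochainPullback_mem_cocycles {c : C' → C' → C' → ℂ} (hc : c ∈ cechCocycles C') :
    cochainPullback q c ∈ cechCocycles C := by
  obtain ⟨U, hU⟩ := hc
  exact ⟨U.preimage hq, fun x y => (hU.1 (q x) (q y)).comp hq.contMDiffOn fun p hp => hp,
    fun x y z p hp => hU.2 _ _ _ _ hp⟩

theorem cochainPullback_mem_coboundaries {c : C' → C' → C' → ℂ} (hc : c ∈ cechCoboundaries C') :
    cochainPullback q c ∈ cechCoboundaries C := by
  obtain ⟨U, h, hh, hU⟩ := hc
  exact ⟨U.preimage hq, fun x p => h (q x) (q p),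
    fun x => (hh (q x)).comp hq.contMDiffOn fun p hp => hp, fun x y p hp => hU _ _ _ hp⟩

/-- The pullback map on `H¹(𝒪)`. -/
def h1Pullback : CechH1 C' →ₗ[ℂ] CechH1 C :=
  SubQuot.map (cochainPullback q) (fun _ => cochainPullback_mem_cocycles hq)
    fun _ _ => cochainPullback_mem_coboundaries hq

end Pullback

/-! ### The trace of a free automorphism on the first cohomology -/

section Lefschetz

open Filter Topology

variable {C : Type u} [TopologicalSpace C] [ChartedSpace ℂ C]

/-- The functions vanishing outside a discrete set. -/
def negligible (C : Type u) [TopologicalSpace C] : Submodule ℂ (C → ℂ) where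
  carrier := {f | ∀ x, ∀ᶠ p in 𝓝[≠] x, f p = 0}
  zero_mem' := fun _ => Eventually.of_forall fun _ => rfl
  add_mem' := fun hf hg x => by
    filter_upwards [hf x, hg x] with p h1 h2
    simp [h1, h2]
  smul_mem' := fun a f hf x => by
    filter_upwards [hf x] with p h1
    simp [h1]

theorem mem_negligible_iff {f : C → ℂ} : f ∈ negligible C ↔ ∀ x, ordAt f x = ⊤ :=
  forall_congr' fun _ => ordAt_eq_top_iff.symm

theorem negligible_congr {f g : C → ℂ} (h : ∀ x, f =ᶠ[𝓝[≠] x] g) : f - g ∈ negligible C :=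
  fun x => (h x).mono fun p hp => by simp [hp]

variable [IsManifold 𝓘(ℂ) ω C]

/-- Pullback of functions. -/
def funPullback (σ : C → C) : (C → ℂ) →ₗ[ℂ] (C → ℂ) where
  toFun f := f ∘ σ
  map_add' _ _ := rfl
  map_smul' _ _ := rfl

/-- Pullback of adeles. -/
def adelePullback (σ : C → C) : (C → C → ℂ) →ₗ[ℂ] (C → C → ℂ) where
  toFun u x p := u (σ x) (σ p)
  map_add' _ _ := rfl
  map_smul' _ _ := rfl

/-- A function as a constant family of germs. -/
def diagAdele : (C → ℂ) →ₗ[ℂ] (C → C → ℂ) where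
  toFun f _ := f
  map_add' _ _ := rfl
  map_smul' _ _ := rfl

section Perm

variable {σ : Equiv.Perm C} (h1 : ContMDiff 𝓘(ℂ) 𝓘(ℂ) ω σ) (h2 : ContMDiff 𝓘(ℂ) 𝓘(ℂ) ω σ.symm)
include h1 h2

theorem funPullback_mem_meroGE {D : C → ℤ} (hD : ∀ x, D (σ x) = D x) {f : C → ℂ}
    (hf : f ∈ meroGE D) : funPullback σ f ∈ meroGE D := fun x => by
  have := hf (σ x)
  rw [hD] at this
  exact this.comp_biholomorphic h1 h2

theorem funPullback_mem_negligible {f : C → ℂ} (hf : f ∈ negligible C) :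
    funPullback σ f ∈ negligible C := by
  rw [mem_negligible_iff] at hf ⊢
  exact fun x => (inChart_comp_biholomorphic h1 h2 f x).2.trans (hf (σ x))

theorem adelePullback_mem_adelesGE {D : C → ℤ} (hD : ∀ x, D (σ x) = D x) {u : C → C → ℂ}
    (hu : u ∈ adelesGE D) : adelePullback σ u ∈ adelesGE D := by
  have h : ∀ x, OrdGE (adelePullback σ u x) x (-D x) := fun x => by
    have := hu.2 (σ x)
    rw [hD] at this
    exact this.comp_biholomorphic h1 h2
  refine ⟨⟨fun x => (h x).1, (hu.1.2.preimage σ.injective.injOn).subset fun x hx hx' => hx ?_⟩, h⟩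
  exact ContMDiffAt.comp (g := u (σ x)) (f := σ) x hx' h1.contMDiffAt

end Perm

theorem mul_mem_negligible {f : C → ℂ} (g : C → ℂ) (hf : f ∈ negligible C) :
    g * f ∈ negligible C := fun x => (hf x).mono fun p hp => by simp [hp]

variable [CompactSpace C] [T2Space C]

theorem diagAdele_mem {D : C → ℤ} {f : C → ℂ} (hf : f ∈ meroGE D) : diagAdele f ∈ adelesGE D :=
  ⟨IsMero.const_mem_adeles fun x => (hf x).1, hf⟩

theorem negligible_le_meroGE (D : C → ℤ) : negligible C ≤ meroGE D := fun _ hf x =>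
  (ordGE_zero x _).congr ((hf x).mono fun _ hp => hp.symm)

theorem ordGE_of_mem_adelesGE {D : C → ℤ} {u : C → C → ℂ} (hu : u ∈ adelesGE D) (x : C) :
    OrdGE (u x) x (-D x) := hu.2 x

theorem adelesGE_mono {D D' : C → ℤ} (h : D ≤ D') : adelesGE D ≤ adelesGE D' := fun _ hu =>
  ⟨hu.1, fun x => (hu.2 x).mono (neg_le_neg (h x))⟩

theorem meroGE_mono {D D' : C → ℤ} (h : D ≤ D') : meroGE D ≤ meroGE D' := fun _ hu x =>
  (hu x).mono (neg_le_neg (h x))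

theorem single_mem_adelesGE [DecidableEq C] {D : C → ℤ} {x : C} {f : C → ℂ}
    (hf : OrdGE f x (-D x)) : Pi.single x f ∈ adelesGE D := by
  have h : ∀ y, y ≠ x → (Pi.single x f : C → C → ℂ) y = 0 := fun y hy => by
    simp [hy]
  have hord : ∀ y, OrdGE ((Pi.single x f : C → C → ℂ) y) y (-D y) := by
    intro y
    by_cases hy : y = x
    · subst hy; simpa using hf
    · rw [h y hy]; exact ordGE_zero y _
  refine ⟨⟨fun y => (hord y).1, (Set.finite_singleton x).subset fun y hy => ?_⟩, hord⟩
  by_contra hyx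
  refine hy ?_
  rw [h y hyx]
  exact (contMDiffAt_const : HolAt (fun _ : C => (0 : ℂ)) y)

/-- Allowing one more pole order at `a` adds at most a line, spanned by the new leading term. -/
theorem exists_finiteDimensional_adelesGE_le [DecidableEq C] (s : Multiset C) :
    ∃ W : Submodule ℂ (C → C → ℂ), FiniteDimensional ℂ W ∧
      adelesGE (fun x => (s.count x : ℤ)) ≤ adelesGE (0 : C → ℤ) ⊔ W := by
  induction s using Multiset.induction with
  | empty => exact ⟨⊥, inferInstance, le_trans (adelesGE_mono fun x => by simp) le_sup_left⟩
  | cons a s ih =>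
    obtain ⟨W, hW, hsW⟩ := ih
    set n : ℤ := -((s.count a : ℤ) + 1) with hn
    set e : C → C → ℂ := Pi.single a (coordAt a ^ n) with he
    refine ⟨W ⊔ Submodule.span ℂ {e}, inferInstance, fun u hu => ?_⟩
    have ha : OrdGE (u a) a n := by simpa [hn] using hu.2 a
    obtain ⟨c, hc⟩ := ha.exists_sub
    have hmem : u - c • e ∈ adelesGE (fun x => (s.count x : ℤ)) := by
      refine ⟨sub_mem hu.1 (Submodule.smul_mem _ _ (single_mem_adelesGE
        (D := fun x => ((a ::ₘ s).count x : ℤ)) ?_).1), fun x => ?_⟩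
      · simpa [hn] using ordGE_coordAt_zpow a n
      · by_cases hx : x = a
        · subst hx
          simpa [he, hn] using hc
        · simpa [he, hx] using hu.2 x
    rw [← sup_assoc, ← sub_add_cancel u (c • e)]
    exact add_mem (Submodule.mem_sup_left (hsW hmem)) (Submodule.mem_sup_right
      (Submodule.smul_mem _ _ (Submodule.mem_span_singleton_self e)))

theorem finiteDimensional_adelesGE {D : C → ℤ} (h0 : 0 ≤ D) (hD : {x | D x ≠ 0}.Finite) :
    FiniteDimensional ℂ (SubQuot (adelesGE D) (adelesGE 0)) := by
  classical
  set s : Multiset C := ∑ x ∈ hD.toFinset, (D x).toNat • {x} with hs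
  have hle : D ≤ fun x => (s.count x : ℤ) := by
    intro x
    by_cases hx : D x = 0
    · rw [hx]; positivity
    · have : (D x).toNat ≤ s.count x := by
        rw [hs, Multiset.count_sum']
        refine le_trans (by simp) (Finset.single_le_sum (f := fun y =>
          Multiset.count x ((D y).toNat • {y})) (fun _ _ => Nat.zero_le _)
          (hD.mem_toFinset.2 hx))
      have h3 : ((D x).toNat : ℤ) = D x := Int.toNat_of_nonneg (h0 x)
      rw [← h3]
      exact Int.ofNat_le.2 this
  obtain ⟨W, hW, hsW⟩ := exists_finiteDimensional_adelesGE_le s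
  exact SubQuot.finiteDimensional_of_le (adelesGE_mono h0) ((adelesGE_mono hle).trans hsW)

/-- Filling in the removable singularities gives a holomorphic function on a compact connected
manifold, which is constant. -/
theorem sub_const_mem_negligible [ConnectedSpace C] {f : C → ℂ} (hf : f ∈ meroGE 0) :
    ∃ c : ℂ, f - (fun _ => c) ∈ negligible C := by
  classical
  choose c hc using fun x => (hf x).1.exists_holAt_update (by simpa using (hf x).2)
  set g : C → ℂ := fun x => if HolAt f x then f x else c x with hg
  have hgf : ∀ x, g =ᶠ[𝓝[≠] x] f := fun x =>
    (hf x).1.eventually_holAt.mono fun p hp => by simp [hg, hp]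
  have hgh : ContMDiff 𝓘(ℂ) 𝓘(ℂ) ω g := by
    intro x
    by_cases hx : HolAt f x
    · refine hx.congr_of_eventuallyEq ?_
      filter_upwards [eventually_nhdsWithin_iff.1 (hgf x)] with p hp
      by_cases hpx : p = x
      · subst hpx; simp [hg, hx]
      · exact hp hpx
    · exact hc x g (by simp [hg, hx]) (hgf x)
  obtain ⟨a, ha⟩ := (hgh.mdifferentiable (by simp)).exists_eq_const_of_compactSpace
  refine ⟨a, ?_⟩
  have := negligible_congr (fun x => (hgf x).symm)
  rwa [ha] at this

end Lefschetz

/-! ### The trace formula for a divisor invariant under an automorphism -/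

section LefschetzTrace

open Filter Topology

variable {C : Type u} [TopologicalSpace C] [ChartedSpace ℂ C] [IsManifold 𝓘(ℂ) ω C]
  [CompactSpace C] [T2Space C]

section Perm

variable {σ : Equiv.Perm C} (h1 : ContMDiff 𝓘(ℂ) 𝓘(ℂ) ω σ) (h2 : ContMDiff 𝓘(ℂ) 𝓘(ℂ) ω σ.symm)

/-- The action of an automorphism on `H⁰(𝒪(D))`. -/
def meroGEMap {D : C → ℤ} (hD : ∀ x, D (σ x) = D x) :
    SubQuot (meroGE D) (negligible C) →ₗ[ℂ] SubQuot (meroGE D) (negligible C) :=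
  SubQuot.map (funPullback σ) (fun _ => funPullback_mem_meroGE h1 h2 hD)
    fun _ _ => funPullback_mem_negligible h1 h2

/-- The action of an automorphism on the space of principal parts bounded by `D`. -/
def adelesGEMap {D : C → ℤ} (hD : ∀ x, D (σ x) = D x) :
    SubQuot (adelesGE D) (adelesGE 0) →ₗ[ℂ] SubQuot (adelesGE D) (adelesGE 0) :=
  SubQuot.map (adelePullback σ) (fun _ => adelePullback_mem_adelesGE h1 h2 hD)
    fun _ _ => adelePullback_mem_adelesGE h1 h2 fun _ => rfl

/-- The principal parts split into blocks indexed by the support of `D`. As `σ` has no fixed point,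
its matrix has zero diagonal blocks. -/
theorem trace_adelesGEMap {D : C → ℤ} (hD : ∀ x, D (σ x) = D x) (hfin : {x | D x ≠ 0}.Finite)
    (hfree : ∀ x, σ x ≠ x) : LinearMap.trace ℂ _ (adelesGEMap h1 h2 hD) = 0 := by
  classical
  set Q := SubQuot (adelesGE D) (adelesGE (0 : C → ℤ))
  let pr (x : C) : (C → C → ℂ) →ₗ[ℂ] (C → C → ℂ) :=
    LinearMap.single ℂ (fun _ : C => C → ℂ) x ∘ₗ LinearMap.proj x
  have hpr : ∀ x u, pr x u = Pi.single x (u x) := fun x u => rfl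
  let π (x : C) : Q →ₗ[ℂ] Q := SubQuot.map (pr x)
    (fun _ hu => single_mem_adelesGE (ordGE_of_mem_adelesGE hu x))
    (fun _ _ hu => single_mem_adelesGE (ordGE_of_mem_adelesGE hu x))
  have hππ : ∀ x, π x ∘ₗ π x = π x := fun x => by
    refine SubQuot.hom_ext fun a ha => ?_
    refine SubQuot.mk_eq_mk.2 ?_
    have : pr x (pr x a) - pr x a = 0 := by simp [hpr]
    exact this ▸ zero_mem (adelesGE (0 : C → ℤ))
  have hπσ : ∀ x, π x ∘ₗ adelesGEMap h1 h2 hD ∘ₗ π x = 0 := fun x => by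
    refine SubQuot.hom_ext fun a ha => ?_
    refine SubQuot.mk_eq_zero.2 ?_
    have : pr x (adelePullback σ (pr x a)) = 0 := by
      rw [hpr]
      have : adelePullback σ (pr x a) x = 0 := by
        ext p
        simp [adelePullback, hpr, hfree x]
      rw [this, Pi.single_zero]
    exact this ▸ zero_mem (adelesGE (0 : C → ℤ))
  -- Off the support of `D` the component of an adele is already of order at least `0`, so it dies
  -- in the quotient.
  have hid : (LinearMap.id : Q →ₗ[ℂ] Q) = ∑ x ∈ hfin.toFinset, π x := by
    refine SubQuot.hom_ext fun a ha => ?_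
    have hsum : ∀ t : Finset C, ∃ h : (∑ x ∈ t, pr x) a ∈ adelesGE D,
        (∑ x ∈ t, π x) (SubQuot.mk a ha) = SubQuot.mk ((∑ x ∈ t, pr x) a) h := by
      intro t
      induction t using Finset.induction with
      | empty => exact ⟨zero_mem _, rfl⟩
      | insert y t hy ih =>
        obtain ⟨h, ih⟩ := ih
        simp only [Finset.sum_insert hy, LinearMap.add_apply, ih]
        exact ⟨add_mem (single_mem_adelesGE (ordGE_of_mem_adelesGE ha y)) h, rfl⟩
    obtain ⟨hs, this⟩ := hsum hfin.toFinset
    rw [this, LinearMap.id_apply, SubQuot.mk_eq_mk]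
    refine ⟨(sub_mem ha hs).1, fun x => ?_⟩
    have hx : (∑ y ∈ hfin.toFinset, pr y) a x = if D x ≠ 0 then a x else 0 := by
      rw [LinearMap.sum_apply, Finset.sum_apply]
      simp only [hpr, Pi.single_apply, Finset.sum_ite_eq, hfin.mem_toFinset, Set.mem_ofPred_eq]
    rw [Pi.sub_apply, hx]
    by_cases hDx : D x = 0
    · have := ha.2 x
      rw [hDx] at this
      simpa [hDx] using this
    · simpa [hDx] using ordGE_zero x 0
  rw [← mul_one (adelesGEMap h1 h2 hD), show (1 : Module.End ℂ Q) = _ from hid, Finset.mul_sum,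
    map_sum]
  refine Finset.sum_eq_zero fun x _ => ?_
  rw [← hππ x]
  have h3 : LinearMap.trace ℂ Q ((adelesGEMap h1 h2 hD * π x) * π x) =
      LinearMap.trace ℂ Q (π x * (adelesGEMap h1 h2 hD * π x)) := LinearMap.trace_mul_comm _ _ _
  exact h3.trans (by rw [show π x * (adelesGEMap h1 h2 hD * π x) = 0 from hπσ x, map_zero])

theorem finrank_meroGE_zero [ConnectedSpace C] :
    Module.finrank ℂ (SubQuot (meroGE (0 : C → ℤ)) (negligible C)) = 1 := by
  have h1 : (fun _ => 1 : C → ℂ) ∈ meroGE (0 : C → ℤ) := fun x =>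
    HolAt.ordGE (contMDiffAt_const : HolAt (fun _ : C => (1 : ℂ)) x)
  refine finrank_eq_one (SubQuot.mk _ h1) ?_ fun w => ?_
  · obtain ⟨x⟩ := (inferInstance : Nonempty C)
    rw [Ne, SubQuot.mk_eq_zero]
    intro h
    have := nhdsNE_neBot x
    obtain ⟨p, hp⟩ := (h x).exists
    exact one_ne_zero hp
  · obtain ⟨f, hf, rfl⟩ := SubQuot.exists_mk w
    obtain ⟨c, hc⟩ := sub_const_mem_negligible hf
    refine ⟨c, Eq.symm (SubQuot.mk_eq_mk (hb := Submodule.smul_mem _ c h1).2 ?_)⟩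
    convert hc using 2
    ext; simp

instance finiteDimensional_meroGE_zero [ConnectedSpace C] :
    FiniteDimensional ℂ (SubQuot (meroGE (0 : C → ℤ)) (negligible C)) :=
  FiniteDimensional.of_finrank_eq_succ finrank_meroGE_zero

theorem trace_meroGEMap_zero [ConnectedSpace C] :
    LinearMap.trace ℂ _ (meroGEMap h1 h2 (D := 0) fun _ => rfl) = 1 := by
  have : meroGEMap h1 h2 (D := 0) (fun _ => rfl) = LinearMap.id := by
    refine SubQuot.hom_ext fun f hf => ?_
    obtain ⟨c, hc⟩ := sub_const_mem_negligible hf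
    refine SubQuot.mk_eq_mk.2 ?_
    have := sub_mem (funPullback_mem_negligible h1 h2 hc) hc
    convert this using 1
    ext p; simp [funPullback]
  rw [this, LinearMap.trace_id, finrank_meroGE_zero, Nat.cast_one]

/-- The class in `H¹(𝒪)` of a family of principal parts. -/
def principalPartsToH1 (D : C → ℤ) : SubQuot (adelesGE D) (adelesGE 0) →ₗ[ℂ] CechH1 C :=
  SubQuot.map cechδ (fun _ hu => cechδ_mem_cocycles hu.1) fun _ _ hu => cechδ_mem_coboundaries hu

/-- The trace formula, for a divisor `D` such that every class in `H¹(𝒪)` comes from an adele with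
poles bounded by `D`. -/
theorem trace_h1Pullback_add [ConnectedSpace C] [FiniteDimensional ℂ (CechH1 C)] {D : C → ℤ}
    (hD : ∀ x, D (σ x) = D x) (hfin : {x | D x ≠ 0}.Finite) (h0 : 0 ≤ D)
    (hsurj : Function.Surjective (principalPartsToH1 D)) (hfree : ∀ x, σ x ≠ x) :
    LinearMap.trace ℂ _ (meroGEMap h1 h2 hD) + LinearMap.trace ℂ _ (h1Pullback h1) = 1 := by
  have hQ := finiteDimensional_adelesGE h0 hfin
  let i : SubQuot (meroGE (0 : C → ℤ)) (negligible C) →ₗ[ℂ] SubQuot (meroGE D) (negligible C) :=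
    SubQuot.map LinearMap.id (fun _ hf => meroGE_mono h0 hf) fun _ _ hf => hf
  let f : SubQuot (meroGE D) (negligible C) →ₗ[ℂ] SubQuot (adelesGE D) (adelesGE 0) :=
    SubQuot.map diagAdele (fun _ hf => diagAdele_mem hf)
      fun _ _ hf => diagAdele_mem (negligible_le_meroGE 0 hf)
  have hi : Function.Injective i := SubQuot.map_injective fun _ _ hf => hf
  have hif : Function.Exact i f := SubQuot.map_exact (fun a ha => diagAdele_mem ha)
    fun a ha h => ⟨a, fun x => h.2 x, by simp⟩
  have hfp : Function.Exact f (principalPartsToH1 D) := by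
    refine SubQuot.map_exact (fun a _ => ?_) fun u hu h => ?_
    · have : cechδ (diagAdele a) = 0 := by ext x y p; simp [cechδ_apply, diagAdele]
      rw [this]; exact zero_mem _
    · obtain ⟨g, hg, hgx⟩ := exists_mero_of_cechδ_mem_coboundaries hu.1 h
      have hgD : g ∈ meroGE D := fun x => by
        have := (hu.2 x).add (((hgx x).ordGE.const_smul (-1)).mono (by simpa using h0 x))
        convert this using 1
        simp
      refine ⟨g, hgD, (sub_mem (diagAdele_mem hgD) hu).1, fun x => ?_⟩
      have := (hgx x).ordGE.const_smul (-1)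
      convert this using 1
      · ext p; simp [diagAdele]
      · simp
  have hXD : FiniteDimensional ℂ (SubQuot (meroGE D) (negligible C)) := by
    -- `H⁰(𝒪(D))` is an extension of a subspace of the finite-dimensional principal parts by the
    -- constants.
    refine Module.Finite.of_exact (f := i) (g := f.rangeRestrict) (fun x => ?_)
      f.surjective_rangeRestrict
    rw [← hif x, Subtype.ext_iff]
    rfl
  have := LinearMap.trace_add_eq_of_exact hi hsurj hif hfp
    (a := meroGEMap h1 h2 (D := 0) fun _ => rfl) (b := meroGEMap h1 h2 hD)
    (e := adelesGEMap h1 h2 hD) (t := h1Pullback h1)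
    (SubQuot.hom_ext fun _ _ => rfl) (SubQuot.hom_ext fun _ _ => rfl)
    (SubQuot.hom_ext fun _ _ => rfl)
  rw [this, trace_meroGEMap_zero, trace_adelesGEMap h1 h2 hD hfin hfree, add_zero]

end Perm

theorem exists_pole_bound {u : C → C → ℂ} (hu : u ∈ adeles C) :
    ∃ D : C → ℤ, 0 ≤ D ∧ {x | D x ≠ 0}.Finite ∧ u ∈ adelesGE D := by
  refine ⟨fun x => max 0 (-(ordAt (u x) x).untopD 0), fun x => le_max_left _ _,
    hu.2.subset fun x hx hx' => hx ?_, hu, fun x => ⟨hu.1 x, ?_⟩⟩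
  -- A germ that vanishes identically has order `⊤`; the default `0` in `untopD` lets it contribute
  -- nothing to the divisor.
  · have key : ∀ o : WithTop ℤ, 0 ≤ o → max 0 (-o.untopD 0) = 0 := by
      intro o ho
      induction o with
      | top => simp
      | coe n =>
        have : 0 ≤ n := by exact_mod_cast ho
        simpa using this
    exact key _ hx'.ordAt_nonneg
  · have key : ∀ o : WithTop ℤ, ((-max 0 (-o.untopD 0) : ℤ) : WithTop ℤ) ≤ o := by
      intro o
      induction o with
      | top => exact le_top
      | coe n =>
        have : -max 0 (-n) ≤ n := by omega
        exact WithTop.coe_le_coe.2 this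
    exact key _

/-- Lift a finite basis of `H¹` to adeles; the sum of their pole bounds works, and so does anything
larger. -/
theorem exists_principalPartsToH1_surjective [ConnectedSpace C]
    [FiniteDimensional ℂ (CechH1 C)] :
    ∃ D₀ : C → ℤ, 0 ≤ D₀ ∧ {x | D₀ x ≠ 0}.Finite ∧
      ∀ D, D₀ ≤ D → Function.Surjective (principalPartsToH1 D) := by
  let b := Module.finBasis ℂ (CechH1 C)
  choose u hu using fun i => adelesToH1_surjective (b i)
  choose E hE0 hEfin hE using fun i => exists_pole_bound (u i).2
  refine ⟨∑ i, E i, Finset.sum_nonneg fun i _ => hE0 i,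
    (Set.finite_iUnion hEfin).subset fun x hx => ?_, fun D hD => ?_⟩
  · by_contra h
    simp only [Set.mem_iUnion, Set.mem_ofPred_eq, not_exists, not_not] at h
    exact hx (by simp [h])
  · rw [← LinearMap.range_eq_top, ← top_le_iff, ← b.span_eq, Submodule.span_le]
    rintro _ ⟨i, rfl⟩
    have hle : E i ≤ D := le_trans (Finset.single_le_sum (f := E) (fun j _ => hE0 j)
      (Finset.mem_univ i)) hD
    exact ⟨SubQuot.mk (u i).1 (adelesGE_mono hle (hE i)), hu i⟩

end LefschetzTrace

/-! ### Automorphisms of finite order acting freely have trace one -/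

section FreeCyclic

open Filter Topology

variable {C : Type u} [TopologicalSpace C] [ChartedSpace ℂ C] [IsManifold 𝓘(ℂ) ω C]

theorem contMDiff_perm_pow {σ : Equiv.Perm C} (h1 : ContMDiff 𝓘(ℂ) 𝓘(ℂ) ω σ) (k : ℕ) :
    ContMDiff 𝓘(ℂ) 𝓘(ℂ) ω (σ ^ k : Equiv.Perm C) := by
  induction k with
  | zero => exact contMDiff_id
  | succ k ih => rw [pow_succ]; exact ih.comp h1

theorem contMDiff_perm_pow_symm {σ : Equiv.Perm C} (h2 : ContMDiff 𝓘(ℂ) 𝓘(ℂ) ω σ.symm) (k : ℕ) :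
    ContMDiff 𝓘(ℂ) 𝓘(ℂ) ω (σ ^ k : Equiv.Perm C).symm := by
  have : (σ ^ k : Equiv.Perm C).symm = (σ.symm ^ k : Equiv.Perm C) := (inv_pow σ k).symm
  rw [this]
  exact contMDiff_perm_pow h2 k

/-- The sum over a period does not change under a shift. -/
theorem sum_range_shift {A : Type*} [AddCommGroup A] {m : ℕ} {a : ℕ → A} (h : a m = a 0) :
    ∑ k ∈ Finset.range m, a (k + 1) = ∑ k ∈ Finset.range m, a k := by
  have h1 := Finset.sum_range_succ' a m
  rw [Finset.sum_range_succ, h] at h1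
  exact (add_right_cancel h1).symm

variable [CompactSpace C] [T2Space C] [ConnectedSpace C] [FiniteDimensional ℂ (CechH1 C)]
  {σ : Equiv.Perm C} (h1 : ContMDiff 𝓘(ℂ) 𝓘(ℂ) ω σ) (h2 : ContMDiff 𝓘(ℂ) 𝓘(ℂ) ω σ.symm)
  {m : ℕ} (hm : 1 < m) (hσ : σ ^ m = 1)
  (hfree : ∀ k, 0 < k → k < m → ∀ x, (σ ^ k : Equiv.Perm C) x ≠ x)
include h1 h2 hm hσ hfree

/-- Project a function `g` with its only pole at `P` to the `ζ`-eigenspace by the sum of `ζ⁻ᵏ g ∘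
σᵏ` over one period, with `ζ` a primitive `m`-th root of unity. The result is nonzero because only
the term `k = 0` has a pole at `P`. -/
theorem exists_eigenfunction : ∃ (ζ : ℂ) (f : C → ℂ), ζ ≠ 1 ∧ IsMero f ∧ (∀ x, f (σ x) = ζ * f x) ∧
    ∀ x, ∀ᶠ p in 𝓝[≠] x, f p ≠ 0 := by
  obtain ⟨P⟩ := (inferInstance : Nonempty C)
  obtain ⟨g, hg, hgP, hgx⟩ := exists_mero_single_pole P
  have hζ := Complex.isPrimitiveRoot_exp m (by omega)
  set ζ := Complex.exp (2 * Real.pi * Complex.I / m)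
  have hζ0 : ζ ≠ 0 := Complex.exp_ne_zero _
  let t (k : ℕ) : C → ℂ := (ζ⁻¹ ^ k) • (g ∘ (σ ^ k : Equiv.Perm C))
  have htm : ∀ k, IsMero (t k) := fun k x =>
    ((inChart_comp_biholomorphic (contMDiff_perm_pow h1 k) (contMDiff_perm_pow_symm h2 k) g x).1.2
      (hg _)).const_smul _
  have hsum : ∀ s : Finset ℕ, IsMero (∑ k ∈ s, t k) := fun s x => by
    induction s using Finset.induction with
    | empty => exact meroAt_const 0 x
    | insert a s ha ih => rw [Finset.sum_insert ha]; exact (htm a x).add ih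
  refine ⟨ζ, ∑ k ∈ Finset.range m, t k, hζ.ne_one hm, hsum _, fun x => ?_,
    (hsum _).eventually_ne_zero (P := P) fun htop => ?_⟩
  · have h3 := sum_range_shift (m := m) (a := fun k => t k x)
      (by simp [t, hσ, inv_pow, hζ.pow_eq_one])
    rw [Finset.sum_apply, Finset.sum_apply, ← h3, Finset.mul_sum]
    refine Finset.sum_congr rfl fun k _ => ?_
    simp only [t, Pi.smul_apply, smul_eq_mul, Function.comp_apply, pow_succ, Equiv.Perm.coe_mul]
    field_simp
  -- For `0 < k < m` the point `σᵏ P` differs from `P`, so these terms are holomorphic at `P`. If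
  -- the sum vanished near `P`, then `g` would have no pole there.
  · have h4 : ∀ s : Finset ℕ, (∀ k ∈ s, 0 < k ∧ k < m) → OrdGE (∑ k ∈ s, t k) P 0 := by
      intro s hs
      refine HolAt.ordGE ?_
      have : (∑ k ∈ s, t k) = fun x => ∑ k ∈ s, t k x := by ext; simp
      rw [this]
      refine ContMDiffAt.sum fun k hk => ?_
      refine contMDiffAt_const.mul ?_
      exact ContMDiffAt.comp (g := g) P (hgx _ (hfree k (hs k hk).1 (hs k hk).2 P))
        (contMDiff_perm_pow h1 k).contMDiffAt
    have h5 : OrdGE (∑ k ∈ Finset.range m, t k) P 0 := ⟨hsum _ P, by rw [htop]; exact le_top⟩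
    have h6 := h5.add ((h4 ((Finset.range m).erase 0) fun k hk => by
      simp at hk; omega).const_smul (-1))
    have h7 : (∑ k ∈ Finset.range m, t k) + (-1 : ℂ) • ∑ k ∈ (Finset.range m).erase 0, t k = g := by
      rw [← Finset.add_sum_erase _ _ (Finset.mem_range.2 (by omega : 0 < m))]
      simp only [neg_smul, one_smul, add_neg_cancel_right]
      ext x; simp [t]
    rw [h7] at h6
    exact absurd h6.2 (not_le.2 (by exact_mod_cast hgP))

/-- Sum a sufficiently large effective divisor over the powers of `σ`. -/
theorem exists_invariant_divisor : ∃ D₀ : C → ℤ, 0 ≤ D₀ ∧ {x | D₀ x ≠ 0}.Finite ∧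
    (∀ x, D₀ (σ x) = D₀ x) ∧ ∀ D, D₀ ≤ D → Function.Surjective (principalPartsToH1 D) := by
  obtain ⟨D₀, h0, hfin, hsurj⟩ := exists_principalPartsToH1_surjective (C := C)
  refine ⟨fun x => ∑ k ∈ Finset.range m, D₀ ((σ ^ k : Equiv.Perm C) x),
    fun x => Finset.sum_nonneg fun k _ => h0 _, ?_, fun x => ?_, fun D hD => hsurj D
      (le_trans (fun x => ?_) hD)⟩
  · refine ((Finset.range m).finite_toSet.biUnion fun k _ =>
      hfin.preimage (σ ^ k : Equiv.Perm C).injective.injOn).subset fun x hx => ?_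
    obtain ⟨k, hk, hk'⟩ := Finset.exists_ne_zero_of_sum_ne_zero hx
    exact Set.mem_biUnion hk hk'
  · exact sum_range_shift (m := m) (a := fun k => D₀ ((σ ^ k : Equiv.Perm C) x)) (by simp [hσ])
  · exact Finset.single_le_sum (f := fun k => D₀ ((σ ^ k : Equiv.Perm C) x)) (fun k _ => h0 _)
      (Finset.mem_range.2 (by omega : 0 < m))

/-- With `τ` the trace on `H⁰(𝒪(D))` and `t` the trace on `H¹`, the formula for `D` reads `τ + t =
1` and for `D - div f` reads `ζ τ + t = 1`. As `ζ ≠ 1`, this gives `τ = 0` and `t = 1`. -/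
theorem trace_h1Pullback : LinearMap.trace ℂ _ (h1Pullback h1) = 1 := by
  obtain ⟨ζ, f, hζ, hf, hfσ, hfne⟩ := exists_eigenfunction h1 h2 hm hσ hfree
  obtain ⟨D₀, h0, hfin, hDσ, hsurj⟩ := exists_invariant_divisor h1 h2 hm hσ hfree
  have hσx : ∀ x, σ x ≠ x := by simpa using hfree 1 one_pos hm
  have htop : ∀ x, ordAt f x ≠ ⊤ := fun x => (hf x).ordAt_ne_top_iff.2 (hfne x)
  set o : C → ℤ := fun x => (ordAt f x).untop (htop x) with ho
  have hoe : ∀ x, ordAt f x = o x := fun x => (WithTop.coe_untop _ _).symm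
  have hoσ : ∀ x, o (σ x) = o x := by
    intro x
    have h3 := (inChart_comp_biholomorphic h1 h2 f x).2
    have h4 : f ∘ σ = (fun _ => ζ) * f := by ext x; exact hfσ x
    have hζ0 : ζ ≠ 0 := by
      rintro rfl
      have := nhdsNE_neBot (σ x)
      obtain ⟨p, hp⟩ := (hfne (σ x)).exists
      exact hp (by simpa using hfσ (σ.symm p))
    have h5 : ordAt (fun _ : C => ζ) x = 0 := by
      classical
      exact (meromorphicOrderAt_const _ ζ).trans (if_neg hζ0)
    rw [h4, ordAt_mul (meroAt_const ζ x) (hf x), h5, zero_add, hoe, hoe] at h3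
    exact_mod_cast h3.symm
  have hofin : {x | o x ≠ 0}.Finite := by
    refine (finite_not_of_eventually_nhdsNE (P := fun p => HolAt f p ∧ f p ≠ 0)
      fun x => (hf x).eventually_holAt.and (hfne x)).subset fun x hx h => hx ?_
    have h3 : 0 ≤ o x := by exact_mod_cast (hoe x) ▸ h.1.ordAt_nonneg
    have h4 : HolAt f⁻¹ x := ContMDiffAt.inv₀ h.1 h.2
    have h5 := h4.ordAt_nonneg
    rw [ordAt_inv, hoe] at h5
    have h6 : (0 : ℤ) ≤ -o x := by exact_mod_cast h5
    omega
  -- Adding `|o|` makes both `D` and `D' = D - div f` dominate `D₀`, so the trace formula applies to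
  -- each.
  set D : C → ℤ := fun x => D₀ x + |o x| with hD
  set D' : C → ℤ := fun x => D x - o x with hD'
  have hfinD : {x | D x ≠ 0}.Finite := (hfin.union hofin).subset fun x hx => by
    by_contra hc
    simp only [Set.mem_union, Set.mem_ofPred_eq, not_or, not_not] at hc
    exact hx (by simp [hD, hc.1, hc.2])
  have hfinD' : {x | D' x ≠ 0}.Finite := (hfinD.union hofin).subset fun x hx => by
    by_contra hc
    simp only [Set.mem_union, Set.mem_ofPred_eq, not_or, not_not] at hc
    exact hx (by simp [hD', hc.1, hc.2])
  have hle : D₀ ≤ D := fun x => le_add_of_nonneg_right (abs_nonneg _)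
  have hle' : D₀ ≤ D' := fun x => by
    have := le_abs_self (o x)
    simp only [hD', hD]; omega
  have hDs : ∀ x, D (σ x) = D x := fun x => by simp only [hD, hDσ, hoσ]
  have hDs' : ∀ x, D' (σ x) = D' x := fun x => by simp only [hD', hDs, hoσ]
  have e1 := trace_h1Pullback_add h1 h2 hDs hfinD (h0.trans hle) (hsurj D hle) hσx
  have e2 := trace_h1Pullback_add h1 h2 hDs' hfinD' (h0.trans hle') (hsurj D' hle') hσx
  have hfo : ∀ x, OrdGE f x (o x) := fun x => ⟨hf x, (hoe x).ge⟩
  have hfo' : ∀ x, OrdGE f⁻¹ x (-o x) := fun x => ⟨(hf x).inv, by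
    rw [ordAt_inv, hoe]; exact le_rfl⟩
  let μ (k : C → ℂ) : (C → ℂ) →ₗ[ℂ] (C → ℂ) := LinearMap.mulLeft ℂ k
  let a : SubQuot (meroGE D) (negligible C) →ₗ[ℂ] SubQuot (meroGE D') (negligible C) :=
    SubQuot.map (μ f) (fun g hg x => by
      have := (hfo x).mul (hg x)
      rwa [show o x + -D x = -D' x by simp only [hD']; ring] at this)
      fun g _ hg => mul_mem_negligible f hg
  let b : SubQuot (meroGE D') (negligible C) →ₗ[ℂ] SubQuot (meroGE D) (negligible C) :=
    SubQuot.map (μ f⁻¹) (fun g hg x => by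
      have := (hfo' x).mul (hg x)
      rwa [show -o x + -D' x = -D x by simp only [hD']; ring] at this)
      fun g _ hg => mul_mem_negligible f⁻¹ hg
  have hab : a ∘ₗ b = LinearMap.id := SubQuot.hom_ext fun g hg => SubQuot.mk_eq_mk.2
    (negligible_congr fun x => (hfne x).mono fun p hp => by
      change f p * ((f p)⁻¹ * g p) = g p
      field_simp)
  have hba : b ∘ₗ a = LinearMap.id := SubQuot.hom_ext fun g hg => SubQuot.mk_eq_mk.2
    (negligible_congr fun x => (hfne x).mono fun p hp => by
      change (f p)⁻¹ * (f p * g p) = g p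
      field_simp)
  let e : SubQuot (meroGE D) (negligible C) ≃ₗ[ℂ] SubQuot (meroGE D') (negligible C) :=
    LinearEquiv.ofLinearMap a b hab hba
  have hconj : meroGEMap h1 h2 hDs' = ζ • e.conj (meroGEMap h1 h2 hDs) := by
    have h3 : meroGEMap h1 h2 hDs' ∘ₗ a = ζ • (a ∘ₗ meroGEMap h1 h2 hDs) :=
      SubQuot.hom_ext fun g hg => SubQuot.mk_eq_mk.2 (by
        convert zero_mem (negligible C) using 1
        ext p
        change f (σ p) * g (σ p) - ζ * (f p * g (σ p)) = 0
        rw [hfσ]; ring)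
    calc meroGEMap h1 h2 hDs' = (meroGEMap h1 h2 hDs' ∘ₗ a) ∘ₗ b := by
          rw [LinearMap.comp_assoc, hab, LinearMap.comp_id]
      _ = _ := by rw [h3]; rfl
  rw [hconj, map_smul, LinearMap.trace_conj', smul_eq_mul] at e2
  have h3 : (1 - ζ) * LinearMap.trace ℂ _ (meroGEMap h1 h2 hDs) = 0 := by
    linear_combination e1 - e2
  rcases mul_eq_zero.1 h3 with h4 | h4
  · exact absurd (sub_eq_zero.1 h4).symm hζ
  · rwa [h4, zero_add] at e1

end FreeCyclic

/-! ### Free quotients: invariants of the first cohomology -/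

section FreeQuotient

open Filter Topology

variable {C : Type u} [TopologicalSpace C] [ChartedSpace ℂ C] [IsManifold 𝓘(ℂ) ω C]
  {Γ : Subgroup (Equiv.Perm C)} [Finite Γ]
  (hΓ : ∀ γ ∈ Γ, ContMDiff 𝓘(ℂ) 𝓘(ℂ) ω γ) (hfree : ∀ γ ∈ Γ, ∀ x, γ x = x → γ = 1)

/-- The action of a group of automorphisms on `H¹(𝒪)`. -/
def h1Rep : Representation ℂ Γ (CechH1 C) where
  -- Pullback reverses composition; the inverse turns it into a left action.
  toFun γ := h1Pullback (hΓ γ⁻¹.1 γ⁻¹.2)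
  map_one' := SubQuot.hom_ext fun _ _ => rfl
  map_mul' γ δ := SubQuot.hom_ext fun c hc => by
    refine SubQuot.mk_eq_mk.2 ?_
    have : cochainPullback (γ * δ)⁻¹.1 c = cochainPullback γ⁻¹.1 (cochainPullback δ⁻¹.1 c) := by
      rw [mul_inv_rev]; rfl
    exact (sub_eq_zero.2 this) ▸ zero_mem (cechCoboundaries C)

include hfree in
-- The dimension of the invariants is the average of the traces: the identity contributes the genus
-- and each other element contributes `1`.
theorem card_mul_finrank_invariants [CompactSpace C] [T2Space C] [ConnectedSpace C]
    [FiniteDimensional ℂ (CechH1 C)] :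
    Nat.card Γ * Module.finrank ℂ (h1Rep hΓ).invariants + 1 = genus C + Nat.card Γ := by
  classical
  have := Fintype.ofFinite Γ
  have hn : (Fintype.card Γ : ℂ) ≠ 0 := by simp
  have hinv : Invertible (Fintype.card Γ : ℂ) := invertibleOfNonzero hn
  have htr : ∀ γ : Γ, γ ≠ 1 → LinearMap.trace ℂ _ (h1Rep hΓ γ) = 1 := by
    intro γ hγ
    have h1 : orderOf γ⁻¹.1 ≠ 1 := by
      rw [Ne, orderOf_eq_one_iff]
      intro h
      exact hγ (inv_eq_one.1 (Subtype.ext h))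
    have h2 : 0 < orderOf γ⁻¹.1 := by
      rw [Subgroup.orderOf_coe]; exact orderOf_pos _
    refine trace_h1Pullback (m := orderOf γ⁻¹.1) (hΓ _ γ⁻¹.2) (hΓ _ (inv_mem γ⁻¹.2)) (by omega)
      (pow_orderOf_eq_one _) fun k hk0 hk x hx => ?_
    exact pow_ne_one_of_lt_orderOf hk0.ne' hk (hfree _ (pow_mem γ⁻¹.2 k) x hx)
  have h3 := (Representation.isProj_averageMap (h1Rep hΓ)).trace
  simp only [Representation.averageMap, GroupAlgebra.average, map_smul, map_sum,
    Representation.asAlgebraHom_of, smul_eq_mul] at h3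
  rw [← Finset.add_sum_erase _ _ (Finset.mem_univ (1 : Γ)), map_one, LinearMap.trace_one,
    Finset.sum_congr rfl fun γ hγ => htr γ (Finset.ne_of_mem_erase hγ)] at h3
  simp only [Finset.sum_const, Finset.card_erase_of_mem (Finset.mem_univ _), Finset.card_univ,
    nsmul_eq_mul, mul_one] at h3
  have h4 : ((Fintype.card Γ - 1 : ℕ) : ℂ) = Fintype.card Γ - 1 := by
    rw [Nat.cast_sub Fintype.card_pos, Nat.cast_one]
  rw [h4, invOf_eq_inv, inv_mul_eq_iff_eq_mul₀ hn] at h3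
  have h5 : ((Nat.card Γ * Module.finrank ℂ (h1Rep hΓ).invariants + 1 : ℕ) : ℂ) =
      ((genus C + Nat.card Γ : ℕ) : ℂ) := by
    push_cast
    rw [Nat.card_eq_fintype_card, ← h3, genus]
    ring
  exact_mod_cast h5

variable {C' : Type u} [TopologicalSpace C'] [ChartedSpace ℂ C'] {q : C → C'}
  (hq : IsLocalDiffeomorph 𝓘(ℂ) 𝓘(ℂ) ω q) (hsurj : Function.Surjective q)
  (hfib : ∀ x y, q x = q y ↔ ∃ γ ∈ Γ, γ x = y)

include hq in
theorem HolAt.descend {f : C' → ℂ} {p : C} (hf : HolAt (f ∘ q) p) : HolAt f (q p) := by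
  have h1 := hq p
  have h2 : h1.localInverse (q p) = p := h1.localInverse_left_inv h1.localInverse_mem_target
  have h3 : HolAt ((f ∘ q) ∘ h1.localInverse) (q p) :=
    ContMDiffAt.comp (g := f ∘ q) _ (by rwa [h2]) h1.localInverse_contMDiffAt
  refine h3.congr_of_eventuallyEq ?_
  filter_upwards [h1.localInverse_eventuallyEq_right] with y hy
  exact congrArg f hy.symm

include hΓ hfree hq hfib in
-- Start with neighbourhoods on which `q` is injective, so that no nontrivial `γ` maps a point of
-- one into the same one. Intersecting the translates `γ⁻¹ V (γ x)` over the finite group makes the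
-- cover equivariant.
theorem exists_invariant_cover (U₀ : PointedCover C) : ∃ U : PointedCover C,
    (∀ x, U.1 x ≤ U₀.1 x) ∧ (∀ γ ∈ Γ, ∀ x p, p ∈ U.1 x → γ p ∈ U.1 (γ x)) ∧
    ∀ γ ∈ Γ, ∀ x p, p ∈ U.1 x → p ∈ U.1 (γ x) → γ = 1 := by
  choose Φ hxΦ hΦ using hq
  let V (x : C) : Set C := U₀.1 x ∩ (Φ x).source
  have hVo : ∀ x, IsOpen (V x) := fun x => (U₀.1 x).isOpen.inter (Φ x).open_source
  have hV : ∀ γ ∈ Γ, ∀ x p, p ∈ V x → γ p ∈ V x → γ = 1 := by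
    intro γ hγ x p hp hp'
    refine hfree γ hγ p ((Φ x).injOn hp'.2 hp.2 ?_)
    have h := (hfib p (γ p)).2 ⟨γ, hγ, rfl⟩
    rw [hΦ x hp.2, hΦ x hp'.2] at h
    exact h.symm
  refine ⟨⟨fun x => ⟨⋂ γ : Γ, γ.1 ⁻¹' V (γ.1 x), isOpen_iInter_of_finite fun γ =>
    (hVo _).preimage (hΓ γ.1 γ.2).continuous⟩, fun x => Set.mem_iInter.2 fun γ =>
    ⟨U₀.2 _, hxΦ _⟩⟩, fun x p hp => (Set.mem_iInter.1 hp 1).1, fun γ hγ x p hp => ?_,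
    fun γ hγ x p hp hp' => ?_⟩
  · exact Set.mem_iInter.2 fun δ => Set.mem_iInter.1 hp (δ * (⟨γ, hγ⟩ : Γ))
  · have h1 : p ∈ V x := Set.mem_iInter.1 hp 1
    have h2 : γ⁻¹ p ∈ V (γ⁻¹ (γ x)) := Set.mem_iInter.1 hp' ⟨γ⁻¹, inv_mem hγ⟩
    rw [show γ⁻¹ (γ x) = x from γ.symm_apply_apply x] at h2
    exact inv_eq_one.1 (hV γ⁻¹ (inv_mem hγ) x p h1 h2)

include hΓ hfree hq hsurj hfib in
/-- Invariant covers of `C` that are small enough come from the quotient. -/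
theorem exists_descended_cover (U₀ : PointedCover C) :
    ∃ (U : PointedCover C) (U' : PointedCover C'),
    (∀ x, U.1 x ≤ U₀.1 x) ∧ (∀ γ ∈ Γ, ∀ x p, p ∈ U.1 x → γ p ∈ U.1 (γ x)) ∧
    (∀ γ ∈ Γ, ∀ x p, p ∈ U.1 x → p ∈ U.1 (γ x) → γ = 1) ∧
    ∀ x' p, q p ∈ U'.1 x' → ∃ x, q x = x' ∧ p ∈ U.1 x := by
  obtain ⟨U, hU, hUΓ, hU1⟩ := exists_invariant_cover hΓ hfree hq hfib U₀
  choose s hs using hsurj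
  refine ⟨U, ⟨fun x' => ⟨q '' U.1 (s x'), hq.isOpenMap _ (U.1 (s x')).isOpen⟩,
    fun x' => ⟨s x', U.2 _, hs x'⟩⟩, hU, hUΓ, hU1, fun x' p hp => ?_⟩
  obtain ⟨r, hr, hrp⟩ := hp
  obtain ⟨γ, hγ, rfl⟩ := (hfib r p).1 hrp
  exact ⟨γ (s x'), ((hfib _ _).2 ⟨γ, hγ, rfl⟩).symm.trans (hs x'), hUΓ γ hγ _ _ hr⟩

include hΓ hfree hq hsurj hfib

/-- If the pullback is the coboundary of `h₀`, the average `h` of `h₀` over `Γ` has the same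
coboundary and is invariant, so it descends to the quotient. -/
theorem h1Pullback_injective : Function.Injective (h1Pullback hq.contMDiff) := by
  have := Fintype.ofFinite Γ
  have hn : (Fintype.card Γ : ℂ) ≠ 0 := by simp
  refine SubQuot.map_injective fun c' _ hc => ?_
  obtain ⟨U₀, h₀, hh₀, hc⟩ := hc
  obtain ⟨U, U', hU, hUΓ, hU1, hU'⟩ := exists_descended_cover hΓ hfree hq hsurj hfib U₀
  set h : C → C → ℂ := fun x p => (Fintype.card Γ : ℂ)⁻¹ * ∑ γ : Γ, h₀ (γ.1 x) (γ.1 p) with hh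
  have hinv : ∀ γ ∈ Γ, ∀ x p, h (γ x) (γ p) = h x p := by
    intro γ hγ x p
    simp only [hh]
    congr 1
    exact Fintype.sum_equiv (Equiv.mulRight (⟨γ, hγ⟩ : Γ)) _ _ fun δ => rfl
  have hhol : ∀ x, ∀ p ∈ U.1 x, HolAt (h x) p := by
    intro x p hp
    refine contMDiffAt_const.mul (ContMDiffAt.sum fun γ _ => ?_)
    refine ContMDiffAt.comp (g := h₀ (γ.1 x)) p ?_ (hΓ γ.1 γ.2).contMDiffAt
    exact (hh₀ _).contMDiffAt ((U₀.1 _).isOpen.mem_nhds (hU _ (hUΓ γ.1 γ.2 _ _ hp)))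
  have hδ : ∀ x y p, p ∈ U.1 x → p ∈ U.1 y → c' (q x) (q y) (q p) = h y p - h x p := by
    intro x y p hx hy
    have h1 : ∀ γ : Γ, h₀ (γ.1 y) (γ.1 p) - h₀ (γ.1 x) (γ.1 p) = c' (q x) (q y) (q p) := by
      intro γ
      rw [← hc (γ.1 x) (γ.1 y) (γ.1 p)
        ⟨hU _ (hUΓ γ.1 γ.2 _ _ hx), hU _ (hUΓ γ.1 γ.2 _ _ hy)⟩]
      have h2 : ∀ z, q (γ.1 z) = q z := fun z => ((hfib _ _).2 ⟨γ.1, γ.2, rfl⟩).symm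
      change c' (q (γ.1 x)) (q (γ.1 y)) (q (γ.1 p)) = _
      rw [h2, h2, h2]
    simp only [hh]
    rw [← mul_sub, ← Finset.sum_sub_distrib, Finset.sum_congr rfl fun γ _ => h1 γ]
    simp only [Finset.sum_const, Finset.card_univ, nsmul_eq_mul]
    rw [inv_mul_cancel_left₀ hn]
  let π : {z : C × C // z.2 ∈ U.1 z.1} → C' × C' := fun z => (q z.1.1, q z.1.2)
  -- Two pairs over the same image differ by `γ` on the index and `δ` on the point. The sets with
  -- indices `x` and `(γ⁻¹ δ)⁻¹ x` both contain `p`, so smallness of the cover forces `γ = δ`, and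
  -- `h` is invariant under a simultaneous translation.
  have hfac : Function.FactorsThrough (fun z : {z : C × C // z.2 ∈ U.1 z.1} => h z.1.1 z.1.2) π := by
    rintro ⟨⟨x, p⟩, hp⟩ ⟨⟨y, r⟩, hr⟩ hπ
    obtain ⟨hxy, hpr⟩ := Prod.ext_iff.1 hπ
    obtain ⟨γ, hγ, rfl⟩ := (hfib x y).1 hxy
    obtain ⟨δ, hδ', rfl⟩ := (hfib p r).1 hpr
    have h1 := hU1 (γ⁻¹ * δ) (mul_mem (inv_mem hγ) hδ') (((γ⁻¹ * δ)⁻¹ : Equiv.Perm C) x) p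
    have h2 : p ∈ U.1 (((γ⁻¹ * δ)⁻¹ : Equiv.Perm C) x) := by
      have := hUΓ δ⁻¹ (inv_mem hδ') _ _ hr
      simpa using this
    have h3 : γ⁻¹ * δ = 1 := h1 h2 (by simpa using hp)
    rw [inv_mul_eq_one] at h3
    subst h3
    exact (hinv γ hγ x p).symm
  let h' : C' → C' → ℂ := fun x' p' => Function.extend π (fun z => h z.1.1 z.1.2) 0 (x', p')
  have hh' : ∀ x p, p ∈ U.1 x → h' (q x) (q p) = h x p := fun x p hp =>
    hfac.extend_apply 0 ⟨(x, p), hp⟩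
  refine ⟨U', h', fun x' p' hp' => ?_, fun x' y' p' hp' => ?_⟩
  · obtain ⟨p, rfl⟩ := hsurj p'
    obtain ⟨x, rfl, hx⟩ := hU' x' p hp'
    refine (HolAt.descend hq ((hhol x p hx).congr_of_eventuallyEq ?_)).contMDiffWithinAt
    filter_upwards [(U.1 x).isOpen.mem_nhds hx] with r hr using hh' x r hr
  · obtain ⟨p, rfl⟩ := hsurj p'
    obtain ⟨x, rfl, hx⟩ := hU' x' p hp'.1
    obtain ⟨y, rfl, hy⟩ := hU' y' p hp'.2
    rw [hh' x p hx, hh' y p hy, hδ x y p hx hy]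

/-- A class that is invariant up to coboundaries is represented by the average of its translates.
This cocycle is strictly invariant and descends on a small equivariant cover. -/
theorem invariants_le_range_h1Pullback :
    (h1Rep hΓ).invariants ≤ LinearMap.range (h1Pullback hq.contMDiff) := by
  have := Fintype.ofFinite Γ
  have hn : (Fintype.card Γ : ℂ) ≠ 0 := by simp
  intro j hj
  obtain ⟨c₀, hc₀, rfl⟩ := SubQuot.exists_mk j
  have hj' : ∀ γ : Γ, cochainPullback γ.1 c₀ - c₀ ∈ cechCoboundaries C := by
    intro γ
    have h1 : h1Rep hΓ γ⁻¹ (SubQuot.mk c₀ hc₀) = SubQuot.mk c₀ hc₀ := hj γ⁻¹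
    have h2 := SubQuot.mk_eq_mk.1 h1
    rwa [inv_inv] at h2
  set c : C → C → C → ℂ := (Fintype.card Γ : ℂ)⁻¹ • ∑ γ : Γ, cochainPullback γ.1 c₀ with hcdef
  have hcZ : c ∈ cechCocycles C := Submodule.smul_mem _ _
    (sum_mem fun γ _ => cochainPullback_mem_cocycles (hΓ γ.1 γ.2) hc₀)
  have hcB : c - c₀ ∈ cechCoboundaries C := by
    have : c - c₀ = (Fintype.card Γ : ℂ)⁻¹ • ∑ γ : Γ, (cochainPullback γ.1 c₀ - c₀) := by
      rw [Finset.sum_sub_distrib, smul_sub, ← hcdef]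
      simp only [Finset.sum_const, Finset.card_univ]
      rw [← Nat.cast_smul_eq_nsmul ℂ, smul_smul, inv_mul_cancel₀ hn, one_smul]
    rw [this]
    exact Submodule.smul_mem _ _ (sum_mem fun γ _ => hj' γ)
  have hinv : ∀ γ ∈ Γ, ∀ x y p, c (γ x) (γ y) (γ p) = c x y p := by
    intro γ hγ x y p
    simp only [hcdef, Pi.smul_apply, Finset.sum_apply]
    congr 1
    exact Fintype.sum_equiv (Equiv.mulRight (⟨γ, hγ⟩ : Γ)) _ _ fun δ => rfl
  obtain ⟨U₀, hcU⟩ := hcZ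
  obtain ⟨U, U', hU, hUΓ, hU1, hU'⟩ := exists_descended_cover hΓ hfree hq hsurj hfib U₀
  let T := {z : C × C × C // z.2.2 ∈ U.1 z.1 ∧ z.2.2 ∈ U.1 z.2.1}
  let π : T → C' × C' × C' := fun z => (q z.1.1, q z.1.2.1, q z.1.2.2)
  have hfac : Function.FactorsThrough (fun z : T => c z.1.1 z.1.2.1 z.1.2.2) π := by
    rintro ⟨⟨x, y, p⟩, hpx, hpy⟩ ⟨⟨x₁, y₁, p₁⟩, hpx₁, hpy₁⟩ hπ
    obtain ⟨hx, hπ⟩ := Prod.ext_iff.1 hπ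
    obtain ⟨hy, hp⟩ := Prod.ext_iff.1 hπ
    obtain ⟨δ, hδ, rfl⟩ := (hfib p p₁).1 hp
    have key : ∀ x x₁, q x = q x₁ → p ∈ U.1 x → δ p ∈ U.1 x₁ → x₁ = δ x := by
      intro x x₁ hx hp hp₁
      obtain ⟨γ, hγ, rfl⟩ := (hfib x x₁).1 hx
      have h1 := hU1 (γ⁻¹ * δ) (mul_mem (inv_mem hγ) hδ) (((γ⁻¹ * δ)⁻¹ : Equiv.Perm C) x) p
      have h2 : p ∈ U.1 (((γ⁻¹ * δ)⁻¹ : Equiv.Perm C) x) := by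
        have := hUΓ δ⁻¹ (inv_mem hδ) _ _ hp₁
        simpa using this
      have h3 : γ⁻¹ * δ = 1 := h1 h2 (by simpa using hp)
      rw [inv_mul_eq_one] at h3
      rw [h3]
    have e1 := key x x₁ hx hpx hpx₁
    have e2 := key y y₁ hy hpy hpy₁
    change c x y p = c x₁ y₁ (δ p)
    rw [e1, e2, hinv δ hδ]
  let c' : C' → C' → C' → ℂ := fun x' y' p' =>
    Function.extend π (fun z => c z.1.1 z.1.2.1 z.1.2.2) 0 (x', y', p')
  have hc' : ∀ x y p, p ∈ U.1 x → p ∈ U.1 y → c' (q x) (q y) (q p) = c x y p := fun x y p hx hy =>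
    hfac.extend_apply 0 ⟨(x, y, p), hx, hy⟩
  have hc'Z : c' ∈ cechCocycles C' := by
    refine ⟨U', fun x' y' p' hp' => ?_, fun x' y' z' p' hp' => ?_⟩
    · obtain ⟨p, rfl⟩ := hsurj p'
      obtain ⟨x, rfl, hx⟩ := hU' x' p hp'.1
      obtain ⟨y, rfl, hy⟩ := hU' y' p hp'.2
      have h1 : HolAt (c x y) p := (hcU.1 x y).contMDiffAt
        (((U₀.1 x).isOpen.inter (U₀.1 y).isOpen).mem_nhds ⟨hU x hx, hU y hy⟩)
      refine (HolAt.descend hq (h1.congr_of_eventuallyEq ?_)).contMDiffWithinAt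
      filter_upwards [(U.1 x).isOpen.mem_nhds hx, (U.1 y).isOpen.mem_nhds hy] with r hr hr'
      exact hc' x y r hr hr'
    · obtain ⟨p, rfl⟩ := hsurj p'
      obtain ⟨x, rfl, hx⟩ := hU' x' p hp'.1.1
      obtain ⟨y, rfl, hy⟩ := hU' y' p hp'.1.2
      obtain ⟨z, rfl, hz⟩ := hU' z' p hp'.2
      rw [hc' x y p hx hy, hc' y z p hy hz, hc' x z p hx hz]
      exact hcU.2 x y z p ⟨⟨hU x hx, hU y hy⟩, hU z hz⟩
  refine ⟨SubQuot.mk c' hc'Z, SubQuot.mk_eq_mk.2 ?_⟩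
  have h1 : cochainPullback q c' - c ∈ cechCoboundaries C :=
    ⟨U, 0, fun x => contMDiffOn_const, fun x y p hp => by
      simp only [Pi.sub_apply, Pi.zero_apply, sub_zero]
      exact sub_eq_zero.2 (hc' x y p hp.1 hp.2)⟩
  simpa using add_mem h1 hcB

theorem two_le_genus_quotient [CompactSpace C] [T2Space C] [ConnectedSpace C]
    (hg : 2 ≤ genus C) : 2 ≤ genus C' := by
  -- `Module.finrank` is `0` in infinite dimension, so positive genus already implies finiteness.
  have hfd : FiniteDimensional ℂ (CechH1 C) := FiniteDimensional.of_finrank_pos (by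
    rw [genus] at hg; omega)
  have hinj := h1Pullback_injective hΓ hfree hq hsurj hfib
  have h1 := Submodule.finrank_mono (invariants_le_range_h1Pullback hΓ hfree hq hsurj hfib)
  rw [LinearMap.finrank_range_of_inj hinj] at h1
  have h2 := card_mul_finrank_invariants hΓ hfree
  have h3 : 0 < Nat.card Γ := Nat.card_pos
  refine le_trans ?_ h1
  by_contra hlt
  have h4 : Module.finrank ℂ (h1Rep hΓ).invariants ≤ 1 := by omega
  have := Nat.mul_le_mul_left (Nat.card Γ) h4
  omega

end FreeQuotient

/-! ### The quotient of a Riemann surface by a free finite group -/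

section QuotientSurface

open Filter Topology

variable {C : Type u} [TopologicalSpace C] [ChartedSpace ℂ C] [IsManifold 𝓘(ℂ) ω C]
  {Γ : Subgroup (Equiv.Perm C)} (hΓ : ∀ γ ∈ Γ, ContMDiff 𝓘(ℂ) 𝓘(ℂ) ω γ)
  {Q : Type u} [TopologicalSpace Q] {π : C → Q} (hπ : IsLocalHomeomorph π)
  (hfib : ∀ x y, π x = π y ↔ ∃ γ ∈ Γ, γ x = y)
include hΓ hπ hfib

/-- Near `z`, a local section of `π` composed with `π` is a single deck transformation, hence
holomorphic. This gives both the transition maps of the quotient and the regularity of `π` and its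
local inverses. -/
theorem contMDiffAt_localInverseAt_comp {a z : C} (hz : π z ∈ (hπ.localInverseAt a).source) :
    ContMDiffAt 𝓘(ℂ) 𝓘(ℂ) ω (hπ.localInverseAt a ∘ π) z := by
  set L := hπ.localInverseAt a
  have hLπ : ∀ y ∈ L.source, π (L y) = y := fun y hy => hπ.apply_localInverseAt_of_mem hy
  obtain ⟨γ, hγ, hγz⟩ := (hfib z (L (π z))).1 (hLπ _ hz).symm
  have hsrc : ∀ᶠ w in 𝓝 z, π w ∈ L.source :=
    hπ.continuous.continuousAt.eventually (L.open_source.mem_nhds hz)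
  have htgt : ∀ᶠ w in 𝓝 z, γ w ∈ L.target := by
    refine (hΓ γ hγ).continuous.continuousAt.eventually (L.open_target.mem_nhds ?_)
    rw [hγz]
    exact L.map_source hz
  refine ((hΓ γ hγ).contMDiffAt (x := z)).congr_of_eventuallyEq ?_
  filter_upwards [hsrc, htgt] with w hw hw'
  refine hπ.injOn_localInverseAt_target (x := a) (L.map_source hw) hw' ?_
  exact (hLπ _ hw).trans ((hfib _ _).2 ⟨γ, hγ, rfl⟩)

variable {s : Q → C} (hs : Function.RightInverse s π)

theorem isManifold_quotient :
    letI := hπ.chartedSpaceOfRightInverse (H := ℂ) hs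
    IsManifold 𝓘(ℂ) ω Q := by
  let := hπ.chartedSpaceOfRightInverse (H := ℂ) hs
  refine isManifold_of_contDiffOn _ _ _ ?_
  rintro _ _ ⟨a, rfl⟩ ⟨b, rfl⟩ z hz
  simp only [OpenPartialHomeomorph.trans_symm_eq_symm_trans_symm, modelWithCornersSelf_coe,
    modelWithCornersSelf_coe_symm, Set.preimage_id, Set.range_id, Set.inter_univ, Function.comp_id,
    Function.id_comp, OpenPartialHomeomorph.coe_trans, hπ.localInverseAt_symm,
    OpenPartialHomeomorph.trans_source, OpenPartialHomeomorph.symm_source, Set.mem_inter_iff,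
    Set.mem_preimage, Function.comp_apply] at hz ⊢
  obtain ⟨⟨h1, h2⟩, h3, h4⟩ := hz
  refine ContDiffAt.contDiffWithinAt ?_
  rw [← contMDiffAt_iff_contDiffAt]
  exact ContMDiffAt.comp (g := chartAt ℂ (s b)) z (chart_contMDiffAt h4)
    (ContMDiffAt.comp (g := hπ.localInverseAt (s b) ∘ π) z
      (contMDiffAt_localInverseAt_comp hΓ hπ hfib h3) (chart_symm_contMDiffAt h1))

theorem isLocalDiffeomorph_quotient :
    letI := hπ.chartedSpaceOfRightInverse (H := ℂ) hs
    IsLocalDiffeomorph 𝓘(ℂ) 𝓘(ℂ) ω π := by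
  let := hπ.chartedSpaceOfRightInverse (H := ℂ) hs
  have hchart : ∀ y : Q, chartAt ℂ y =
      (hπ.localInverseAt (s y)).trans (chartAt ℂ (s y)) := fun y => rfl
  have hsrc : ∀ y, y ∈ (hπ.localInverseAt (s y)).source := fun y => by
    have := hπ.apply_self_mem_localInverseAt_source (x := s y)
    rwa [hs y] at this
  have hLs : ∀ y, hπ.localInverseAt (s y) y = s y := fun y => by
    have := hπ.localInverseAt_apply_self (x := s y)
    rwa [hs y] at this
  have h1 : ContMDiff 𝓘(ℂ) 𝓘(ℂ) ω π := by
    intro x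
    rw [contMDiffAt_iff_target]
    refine ⟨hπ.continuous.continuousAt, ?_⟩
    simp only [mfld_simps, hchart]
    refine ContMDiffAt.comp (g := chartAt ℂ (s (π x))) (f := hπ.localInverseAt (s (π x)) ∘ π) x
      (chart_contMDiffAt ?_) (contMDiffAt_localInverseAt_comp hΓ hπ hfib (hsrc _))
    rw [Function.comp_apply, hLs]
    exact mem_chart_source ℂ _
  have h2 : ∀ a, ∀ y ∈ (hπ.localInverseAt a).source,
      ContMDiffAt 𝓘(ℂ) 𝓘(ℂ) ω (hπ.localInverseAt a) y := by
    intro a y hy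
    rw [contMDiffAt_iff_source]
    simp only [mfld_simps, hchart]
    refine ContMDiffAt.contMDiffWithinAt ?_
    rw [hLs, hπ.localInverseAt_symm]
    refine ContMDiffAt.comp (g := hπ.localInverseAt a ∘ π) _ ?_
      (chart_symm_contMDiffAt (mem_chart_target ℂ (s y)))
    rw [(chartAt ℂ (s y)).left_inv (mem_chart_source ℂ _)]
    exact contMDiffAt_localInverseAt_comp hΓ hπ hfib (by rwa [hs y])
  intro x
  let L := hπ.localInverseAt x
  refine ⟨⟨L.toPartialEquiv.symm, L.open_target, L.open_source, ?_, ?_⟩, ?_, ?_⟩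
  · exact fun y _ => by
      change ContMDiffWithinAt _ _ _ L.symm _ _
      rw [hπ.localInverseAt_symm]
      exact (h1 y).contMDiffWithinAt
  · exact fun y hy => (h2 x y hy).contMDiffWithinAt
  · exact hπ.self_mem_localInverseAt_target
  · intro y _
    change π y = L.symm y
    rw [hπ.localInverseAt_symm]

end QuotientSurface

namespace CompactRiemannSurface

theorem exists_quotient (C : CompactRiemannSurface.{u}) (Γ : Subgroup (Equiv.Perm C)) [Finite Γ]
    (hΓ : ∀ γ ∈ Γ, ContMDiff 𝓘(ℂ) 𝓘(ℂ) ω γ) (hfree : ∀ γ ∈ Γ, ∀ x, γ x = x → γ = 1) :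
    ∃ (C' : CompactRiemannSurface.{u}) (q : C → C'), Function.Surjective q ∧
      IsLocalDiffeomorph 𝓘(ℂ) 𝓘(ℂ) ω q ∧ ∀ x y, q x = q y ↔ ∃ γ ∈ Γ, γ x = y := by
  have i1 : ContinuousConstSMul Γ C := ⟨fun γ => (hΓ γ.1 γ.2).continuous⟩
  have i2 : IsCancelSMul Γ C := isCancelSMul_iff_eq_one_of_smul_eq.2 fun γ x h =>
    Subtype.ext (hfree γ.1 γ.2 x h)
  let Q := MulAction.orbitRel.Quotient Γ C
  let π : C → Q := Quotient.mk _
  have hπ : IsLocalHomeomorph π :=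
    isQuotientCoveringMap_quotientMk_of_properlyDiscontinuousSMul.isCoveringMap.isLocalHomeomorph
  have hsurj : Function.Surjective π := Quotient.mk_surjective
  have hfib : ∀ x y, π x = π y ↔ ∃ γ ∈ Γ, γ x = y := by
    intro x y
    refine Quotient.eq.trans ?_
    rw [MulAction.orbitRel_apply]
    constructor
    · rintro ⟨γ, hγ⟩
      exact ⟨γ.1⁻¹, inv_mem γ.2, by rw [← hγ]; exact γ.1.symm_apply_apply y⟩
    · rintro ⟨γ, hγ, rfl⟩
      exact ⟨⟨γ⁻¹, inv_mem hγ⟩, γ.symm_apply_apply x⟩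
  have hs := hsurj.hasRightInverse.choose_spec
  let ch := hπ.chartedSpaceOfRightInverse (H := ℂ) hs
  have : IsManifold 𝓘(ℂ) ω Q := isManifold_quotient hΓ hπ hfib hs
  have : CompactSpace Q := inferInstanceAs (CompactSpace (MulAction.orbitRel.Quotient Γ C))
  have : T2Space Q := inferInstanceAs (T2Space (MulAction.orbitRel.Quotient Γ C))
  have : ConnectedSpace Q := inferInstanceAs (ConnectedSpace (MulAction.orbitRel.Quotient Γ C))
  exact ⟨⟨Q⟩, π, hsurj, isLocalDiffeomorph_quotient hΓ hπ hfib hs, hfib⟩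

end CompactRiemannSurface

/-! ### Local diffeomorphisms and descent of maps -/

section LocalDiffeomorph

variable {𝕜 : Type*} [NontriviallyNormedField 𝕜]
  {E F G E' F' : Type*} [NormedAddCommGroup E] [NormedSpace 𝕜 E] [NormedAddCommGroup F]
  [NormedSpace 𝕜 F] [NormedAddCommGroup G] [NormedSpace 𝕜 G]
  [NormedAddCommGroup E'] [NormedSpace 𝕜 E'] [NormedAddCommGroup F'] [NormedSpace 𝕜 F']
  {H₁ H₂ H₃ H₁' H₂' : Type*} [TopologicalSpace H₁] [TopologicalSpace H₂] [TopologicalSpace H₃]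
  [TopologicalSpace H₁'] [TopologicalSpace H₂']
  {I : ModelWithCorners 𝕜 E H₁} {J : ModelWithCorners 𝕜 F H₂} {K : ModelWithCorners 𝕜 G H₃}
  {I' : ModelWithCorners 𝕜 E' H₁'} {J' : ModelWithCorners 𝕜 F' H₂'}
  {M N P M' N' : Type*} [TopologicalSpace M] [ChartedSpace H₁ M] [TopologicalSpace N]
  [ChartedSpace H₂ N] [TopologicalSpace P] [ChartedSpace H₃ P] [TopologicalSpace M']
  [ChartedSpace H₁' M'] [TopologicalSpace N'] [ChartedSpace H₂' N'] {n : WithTop ℕ∞}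

theorem IsLocalDiffeomorph.of_comp {q : M → N} (hq : IsLocalDiffeomorph I J n q)
    (hsurj : Function.Surjective q) {f : N → P} (hf : IsLocalDiffeomorph I K n (f ∘ q)) :
    IsLocalDiffeomorph J K n f := by
  intro y
  obtain ⟨x, rfl⟩ := hsurj y
  obtain ⟨Ψ, hxΨ, hΨ⟩ := hq x
  obtain ⟨Φ, hxΦ, hΦ⟩ := hf x
  refine ⟨Ψ.symm.trans Φ, ?_, ?_⟩
  · refine ⟨?_, ?_⟩
    · change q x ∈ Ψ.target
      rw [hΨ hxΨ]; exact Ψ.map_source hxΨ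
    · change Ψ.toPartialEquiv.symm (q x) ∈ Φ.source
      rw [hΨ hxΨ]
      exact (Ψ.left_inv hxΨ).symm ▸ hxΦ
  · rintro z ⟨hz1, hz2⟩
    change f z = Φ (Ψ.toPartialEquiv.symm z)
    have h1 : Ψ.toPartialEquiv.symm z ∈ Ψ.source := Ψ.map_target hz1
    have h2 : q (Ψ.toPartialEquiv.symm z) = z := (hΨ h1).trans (Ψ.right_inv hz1)
    exact (congrArg f h2).symm.trans (hΦ hz2)

theorem IsLocalDiffeomorph.prodMap {f : M → N} (hf : IsLocalDiffeomorph I J n f) {g : M' → N'}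
    (hg : IsLocalDiffeomorph I' J' n g) :
    IsLocalDiffeomorph (I.prod I') (J.prod J') n (Prod.map f g) := by
  rintro ⟨x, y⟩
  obtain ⟨Φ, hx, hΦ⟩ := hf x
  obtain ⟨Ψ, hy, hΨ⟩ := hg y
  exact ⟨⟨Φ.toPartialEquiv.prod Ψ.toPartialEquiv, Φ.open_source.prod Ψ.open_source,
    Φ.open_target.prod Ψ.open_target, Φ.contMDiffOn_toFun.prodMap Ψ.contMDiffOn_toFun,
    Φ.contMDiffOn_invFun.prodMap Ψ.contMDiffOn_invFun⟩, ⟨hx, hy⟩,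
    fun z hz => Prod.ext (hΦ hz.1) (hΨ hz.2)⟩

theorem IsLocalDiffeomorph.contMDiff_of_comp {q : M → N} (hq : IsLocalDiffeomorph I J n q)
    (hsurj : Function.Surjective q) {f : N → P} (hf : ContMDiff I K n (f ∘ q)) :
    ContMDiff J K n f := by
  intro y
  obtain ⟨x, rfl⟩ := hsurj y
  have h1 := hq x
  have h3 : ContMDiffAt J K n ((f ∘ q) ∘ h1.localInverse) (q x) :=
    ContMDiffAt.comp (g := f ∘ q) _ hf.contMDiffAt h1.localInverse_contMDiffAt
  refine h3.congr_of_eventuallyEq ?_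
  filter_upwards [h1.localInverse_eventuallyEq_right] with z hz
  exact congrArg f hz.symm

end LocalDiffeomorph

namespace CompactRiemannSurface

/-- A group action descends to a quotient. -/
theorem exists_descended_action {C C' : CompactRiemannSurface.{u}} {G : Type*} [Group G]
    (a : G →* C.Aut) {q : C → C'} (hsurj : Function.Surjective q)
    (hq : IsLocalDiffeomorph 𝓘(ℂ) 𝓘(ℂ) ω q)
    (h : ∀ g x y, q x = q y → q ((a g : Equiv.Perm C) x) = q ((a g : Equiv.Perm C) y)) :
    ∃ θ : G →* C'.Aut, ∀ g x, q ((a g : Equiv.Perm C) x) = (θ g : Equiv.Perm C') (q x) := by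
  choose s hs using hsurj
  let f (g : G) (y : C') : C' := q ((a g : Equiv.Perm C) (s y))
  have hf : ∀ g x, f g (q x) = q ((a g : Equiv.Perm C) x) := fun g x => h g _ _ (hs _)
  have hsm : ∀ g, ContMDiff 𝓘(ℂ) 𝓘(ℂ) ω (f g) := fun g =>
    hq.contMDiff_of_comp (fun y => ⟨s y, hs y⟩) (by
      have : f g ∘ q = q ∘ (a g : Equiv.Perm C) := funext (hf g)
      rw [this]
      exact hq.contMDiff.comp (a g).2.1)
  have hone : ∀ y, f 1 y = y := fun y => by simp [f, hs]
  have hmul : ∀ g k y, f (g * k) y = f g (f k y) := fun g k y => by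
    conv_rhs => rw [show f k y = q ((a k : Equiv.Perm C) (s y)) from rfl, hf]
    simp [f]
  let P (g : G) : Equiv.Perm C' := ⟨f g, f g⁻¹, fun y => by rw [← hmul, inv_mul_cancel, hone],
    fun y => by rw [← hmul, mul_inv_cancel, hone]⟩
  exact ⟨{ toFun := fun g => ⟨P g, hsm g, hsm g⁻¹⟩
           map_one' := Subtype.ext (Equiv.ext hone)
           map_mul' := fun g k => Subtype.ext (Equiv.ext (hmul g k)) }, fun g x => (hf g x).symm⟩

end CompactRiemannSurface

/-! ### The kernels of a realization and the quotient curves -/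

namespace Realization

variable {X : Type v} [TopologicalSpace X] [ChartedSpace (EuclideanSpace ℂ (Fin 3)) X]
  (R : Realization.{u} X)

/-- The action of an element of the group on the `i`-th curve. -/
abbrev act (g : R.G) (i : Fin 3) (x : R.C i) : R.C i := (R.ψ i g : Equiv.Perm (R.C i)) x

theorem act_mul (g h : R.G) (i : Fin 3) (x : R.C i) :
    R.act (g * h) i x = R.act g i (R.act h i x) := by simp [act]

variable {R}

theorem mem_K {g : R.G} {i : Fin 3} : g ∈ R.K i ↔ ∀ x, R.act g i x = x := by
  rw [K, MonoidHom.mem_ker, Subtype.ext_iff, Equiv.ext_iff]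
  rfl

theorem mem_otherKernels {g : R.G} {k : Fin 3} :
    g ∈ R.otherKernels k ↔ ∀ i, i ≠ k → ∀ x, R.act g i x = x := by
  simp only [otherKernels, Subgroup.mem_iInf, mem_K]

theorem eq_of_act_eq {g h : R.G} (p : ∀ i, R.C i) (hp : ∀ i, R.act g i (p i) = R.act h i (p i)) :
    g = h := by
  have h1 : (h⁻¹ * g).1 = 1 := R.free _ (h⁻¹ * g).2 p fun i => by
    change R.act (h⁻¹ * g) i (p i) = p i
    rw [act_mul, hp, ← act_mul, inv_mul_cancel]
    simp [act]
  have h2 : h⁻¹ * g = 1 := Subtype.ext h1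
  exact (inv_mul_eq_one.1 h2).symm

/-- This is freeness of `otherKernels k` on `C k`: complete `x` by arbitrary points on the other two
curves, where both elements act trivially, and use freeness on the product. -/
theorem eq_of_act_eq_of_mem {k : Fin 3} {g h : R.G} (hg : g ∈ R.otherKernels k)
    (hh : h ∈ R.otherKernels k) {x : R.C k} (hx : R.act g k x = R.act h k x) : g = h := by
  classical
  refine eq_of_act_eq (Function.update (fun i => Classical.arbitrary (R.C i)) k x) fun i => ?_
  by_cases hik : i = k
  · subst hik; simpa using hx
  · rw [mem_otherKernels.1 hg i hik, mem_otherKernels.1 hh i hik]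

/-- Elements of the subgroups `otherKernels k` can be combined. -/
theorem exists_combined {l : Fin 3 → R.G} (hl : ∀ k, l k ∈ R.otherKernels k) :
    ∃ m ∈ ⨆ k, R.otherKernels k, ∀ i x, R.act m i x = R.act (l i) i x := by
  refine ⟨l 0 * l 1 * l 2, mul_mem (mul_mem (Subgroup.mem_iSup_of_mem 0 (hl 0))
    (Subgroup.mem_iSup_of_mem 1 (hl 1))) (Subgroup.mem_iSup_of_mem 2 (hl 2)), fun i x => ?_⟩
  have h := fun k => mem_otherKernels.1 (hl k)
  rw [act_mul, act_mul]
  fin_cases i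
  · exact (congrArg _ ((congrArg _ (h 2 0 (by decide) x)).trans (h 1 0 (by decide) x)))
  · exact (h 0 1 (by decide) _).trans (congrArg _ (h 2 1 (by decide) x))
  · exact (h 0 2 (by decide) _).trans (h 1 2 (by decide) _)

/-- If `g` agrees at every point with some element of `otherKernels k`, the element can be chosen
independently of the point. -/
theorem exists_uniform {g : R.G} {k : Fin 3}
    (h : ∀ x, ∃ l ∈ R.otherKernels k, R.act l k x = R.act g k x) :
    ∃ l ∈ R.otherKernels k, ∀ x, R.act l k x = R.act g k x := by
  have := R.finite
  -- These sets are finitely many, closed, pairwise disjoint by freeness, and cover `C k`. By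
  -- connectedness a nonempty one is everything.
  let A (l : R.otherKernels k) : Set (R.C k) := {x | R.act l.1 k x = R.act g k x}
  have hcont : ∀ l : R.G, Continuous (R.act l k) := fun l => (R.ψ k l).2.1.continuous
  have hclosed : ∀ l, IsClosed (A l) := fun l => isClosed_eq (hcont _) (hcont _)
  have hcompl : ∀ l, (A l)ᶜ = ⋃ l' : {l' // l' ≠ l}, A l'.1 := by
    intro l
    ext x
    simp only [Set.mem_compl_iff, Set.mem_iUnion]
    constructor
    · intro hx
      obtain ⟨l', hl', hx'⟩ := h x
      exact ⟨⟨⟨l', hl'⟩, fun he => hx (he ▸ hx')⟩, hx'⟩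
    · rintro ⟨⟨l', hne⟩, hx'⟩ hx
      exact hne (Subtype.ext (eq_of_act_eq_of_mem l'.2 l.2 (Eq.trans hx' (Eq.symm hx))))
  obtain ⟨x₀⟩ := (inferInstance : Nonempty (R.C k))
  obtain ⟨l, hl, hx₀⟩ := h x₀
  have hclopen : IsClopen (A ⟨l, hl⟩) := by
    refine ⟨hclosed _, ?_⟩
    rw [← isClosed_compl_iff, hcompl]
    exact isClosed_iUnion_of_finite fun l' => hclosed _
  have huniv := hclopen.eq_univ ⟨x₀, hx₀⟩
  exact ⟨l, hl, fun x => (huniv ▸ Set.mem_univ x : x ∈ A ⟨l, hl⟩)⟩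

variable (R)

/-- The group of automorphisms of `C k` given by `otherKernels k`. -/
def deckGroup (k : Fin 3) : Subgroup (Equiv.Perm (R.C k)) :=
  ((R.otherKernels k).map (R.ψ k)).map (R.C k).Aut.subtype

theorem mem_deckGroup {k : Fin 3} {γ : Equiv.Perm (R.C k)} :
    γ ∈ R.deckGroup k ↔ ∃ l ∈ R.otherKernels k, (R.ψ k l : Equiv.Perm (R.C k)) = γ := by
  simp only [deckGroup, Subgroup.mem_map]
  constructor
  · rintro ⟨_, ⟨l, hl, rfl⟩, rfl⟩
    exact ⟨l, hl, rfl⟩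
  · rintro ⟨l, hl, rfl⟩
    exact ⟨_, ⟨l, hl, rfl⟩, rfl⟩

theorem finite_deckGroup (k : Fin 3) : Finite (R.deckGroup k) := by
  have := R.finite
  refine Set.Finite.to_subtype ((Set.finite_range fun l : R.G =>
    (R.ψ k l : Equiv.Perm (R.C k))).subset fun γ hγ => ?_)
  obtain ⟨l, -, rfl⟩ := R.mem_deckGroup.1 hγ
  exact ⟨l, rfl⟩

theorem exists_quotient_curve (k : Fin 3) : ∃ (C' : CompactRiemannSurface.{u}) (q : R.C k → C'),
    2 ≤ genus C' ∧ Function.Surjective q ∧ IsLocalDiffeomorph 𝓘(ℂ) 𝓘(ℂ) ω q ∧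
    ∀ x y, q x = q y ↔ ∃ l ∈ R.otherKernels k, R.act l k x = y := by
  have := R.finite_deckGroup k
  have hΓ : ∀ γ ∈ R.deckGroup k, ContMDiff 𝓘(ℂ) 𝓘(ℂ) ω γ := fun γ hγ => by
    obtain ⟨l, -, rfl⟩ := R.mem_deckGroup.1 hγ
    exact (R.ψ k l).2.1
  have hfree : ∀ γ ∈ R.deckGroup k, ∀ x, γ x = x → γ = 1 := fun γ hγ x hx => by
    obtain ⟨l, hl, rfl⟩ := R.mem_deckGroup.1 hγ
    have : l = 1 := eq_of_act_eq_of_mem hl (one_mem _) (x := x) (by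
      rw [act, hx]; simp [act])
    rw [this]; simp
  obtain ⟨C', q, h1, h2, h3⟩ := (R.C k).exists_quotient (R.deckGroup k) hΓ hfree
  refine ⟨C', q, two_le_genus_quotient hΓ hfree h2 h1 h3 (R.two_le_genus k), h1, h2,
    fun x y => (h3 x y).trans ⟨?_, ?_⟩⟩
  · rintro ⟨γ, hγ, rfl⟩
    obtain ⟨l, hl, rfl⟩ := R.mem_deckGroup.1 hγ
    exact ⟨l, hl, rfl⟩
  · rintro ⟨l, hl, rfl⟩
    exact ⟨_, R.mem_deckGroup.2 ⟨l, hl, rfl⟩, rfl⟩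

end Realization

/-! ### Construction of the minimal realization -/

namespace Realization

variable {X : Type v} [TopologicalSpace X] [ChartedSpace (EuclideanSpace ℂ (Fin 3)) X]
  {R : Realization.{u} X}

theorem proj_eq_iff_exists_act {p p' : ∀ i, R.C i} :
    R.proj (p 0, p 1, p 2) = R.proj (p' 0, p' 1, p' 2) ↔ ∃ g : R.G, ∀ i, R.act g i (p i) = p' i := by
  rw [R.proj_eq_iff]
  constructor
  · rintro ⟨g, hg, h0, h1, h2⟩
    refine ⟨⟨g, hg⟩, fun i => ?_⟩
    fin_cases i
    exacts [h0, h1, h2]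
  · rintro ⟨g, h⟩
    exact ⟨g.1, g.2, h 0, h 1, h 2⟩

theorem conj_mem_otherKernels (g : R.G) {l : R.G} {k : Fin 3} (hl : l ∈ R.otherKernels k) :
    g * l * g⁻¹ ∈ R.otherKernels k := by
  rw [mem_otherKernels] at hl ⊢
  intro i hi x
  rw [act_mul, act_mul, hl i hi, ← act_mul, mul_inv_cancel]
  simp [act]

/-- Combine the coordinatewise corrections into one element of the join; it agrees with `g` at `p`,
so freeness identifies the two. -/
theorem mem_iSup_otherKernels_of_act_eq {g : R.G} (p : ∀ i, R.C i)
    (h : ∀ i, ∃ l ∈ R.otherKernels i, R.act l i (p i) = R.act g i (p i)) :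
    g ∈ ⨆ k, R.otherKernels k := by
  choose l hl hlg using h
  obtain ⟨m, hm, hml⟩ := exists_combined hl
  rwa [eq_of_act_eq p fun i => ((hml i (p i)).trans (hlg i)).symm]

theorem exists_isMinimal_isQuotientByOtherKernels (R : Realization.{u} X) :
    ∃ S : Realization.{u} X, S.IsMinimal ∧ R.IsQuotientByOtherKernels S := by
  have := R.finite
  choose C' q hgen hsurj hld hfib using R.exists_quotient_curve
  have hequiv : ∀ k g x y, q k x = q k y → q k (R.act g k x) = q k (R.act g k y) := by
    intro k g x y hxy
    obtain ⟨l, hl, rfl⟩ := (hfib k x y).1 hxy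
    refine (hfib k _ _).2 ⟨_, conj_mem_otherKernels g hl, ?_⟩
    simp only [← act_mul, inv_mul_cancel_right]
  have hθ : ∀ k, ∃ θ : R.G →* (C' k).Aut,
      ∀ g x, q k (R.act g k x) = (θ g : Equiv.Perm (C' k)) (q k x) := fun k =>
    CompactRiemannSurface.exists_descended_action (R.ψ k) (hsurj k) (hld k) (hequiv k)
  choose θ hθ using hθ
  let Ψ : R.G →* ∀ k, (C' k).Aut := MonoidHom.pi θ
  have htriv : ∀ k g, θ k g = 1 ↔ ∀ x, q k (R.act g k x) = q k x := by
    intro k g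
    rw [Subtype.ext_iff, Equiv.ext_iff, (hsurj k).forall]
    simp only [hθ]
    rfl
  have hle : ⨆ k, R.otherKernels k ≤ Ψ.ker := iSup_le fun k l hl => by
    rw [MonoidHom.mem_ker]
    refine funext fun i => (htriv i l).2 fun x => ?_
    by_cases hik : i = k
    · subst hik
      exact ((hfib i _ _).2 ⟨l, hl, rfl⟩).symm
    · rw [mem_otherKernels.1 hl i hik]
  have hfix : ∀ (g : R.G) (p : ∀ i, R.C i), (∀ i, q i (R.act g i (p i)) = q i (p i)) →
      g ∈ ⨆ k, R.otherKernels k := fun g p h =>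
    mem_iSup_otherKernels_of_act_eq p fun i => (hfib i _ _).1 (h i).symm
  have hker : Ψ.ker = ⨆ k, R.otherKernels k := le_antisymm (fun g hg => by
    refine hfix g (fun i => Classical.arbitrary _) fun i => (htriv i g).1 (congrFun hg i) _) hle
  choose s hs using hsurj
  let proj' : C' 0 × C' 1 × C' 2 → X := fun p => R.proj (s 0 p.1, s 1 p.2.1, s 2 p.2.2)
  have hproj : ∀ p p' : ∀ i, R.C i, R.proj (p 0, p 1, p 2) = R.proj (p' 0, p' 1, p' 2) ↔
      ∃ g : R.G, ∀ i, (θ i g : Equiv.Perm (C' i)) (q i (p i)) = q i (p' i) := by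
    intro p p'
    rw [proj_eq_iff_exists_act]
    constructor
    · rintro ⟨g, hg⟩
      exact ⟨g, fun i => by rw [← hθ, hg]⟩
    · rintro ⟨g, hg⟩
      -- Points with the same orbit in the quotient product lift to the same `G`-orbit: the
      -- remaining discrepancies lie in the `otherKernels i` and can be corrected by one group
      -- element.
      have h : ∀ i, ∃ l ∈ R.otherKernels i, R.act l i (R.act g i (p i)) = p' i := fun i =>
        (hfib i _ _).1 ((hθ i g (p i)).trans (hg i))
      choose l hl hlp using h
      obtain ⟨m, -, hm⟩ := exists_combined hl
      exact ⟨m * g, fun i => by rw [act_mul, hm, hlp]⟩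
  have hproj' : ∀ p : R.C 0 × R.C 1 × R.C 2,
      R.proj p = proj' (q 0 p.1, q 1 p.2.1, q 2 p.2.2) := by
    rintro ⟨x, y, z⟩
    have hc := (hproj (Fin.cons x (Fin.cons y (Fin.cons z finZeroElim)))
      (Fin.cons (s 0 (q 0 x)) (Fin.cons (s 1 (q 1 y)) (Fin.cons (s 2 (q 2 z)) finZeroElim)))).2
      ⟨1, fun i => by
        rw [map_one]
        fin_cases i
        exacts [(hs 0 _).symm, (hs 1 _).symm, (hs 2 _).symm]⟩
    exact hc
  have hqs : Function.Surjective (Prod.map (q 0) (Prod.map (q 1) (q 2))) :=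
    (Function.RightInverse.surjective (hs 0)).prodMap
      ((Function.RightInverse.surjective (hs 1)).prodMap
        (Function.RightInverse.surjective (hs 2)))
  let S : Realization.{u} X :=
    { C := C'
      two_le_genus := hgen
      -- The image in the automorphism groups stands for `G / K`; since `Ψ.ker` is `K`, the two are
      -- isomorphic and faithfulness is built in.
      G := Ψ.range
      finite := Set.finite_range Ψ
      free := by
        rintro _ ⟨g, rfl⟩ p hp
        refine MonoidHom.mem_ker.1 (hle (hfix g (fun i => s i (p i)) fun i => ?_))
        rw [hθ, hs]
        exact hp i
      proj := proj'
      proj_surjective := fun x => by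
        obtain ⟨p, rfl⟩ := R.proj_surjective x
        exact ⟨_, (hproj' p).symm⟩
      proj_isLocalDiffeomorph :=
        ((hld 0).prodMap ((hld 1).prodMap (hld 2))).of_comp hqs (by
          convert R.proj_isLocalDiffeomorph using 1
          exact funext fun p => (hproj' p).symm)
      proj_eq_iff := by
        rintro ⟨x, y, z⟩ ⟨x', y', z'⟩
        have h := hproj (Fin.cons (s 0 x) (Fin.cons (s 1 y) (Fin.cons (s 2 z) finZeroElim)))
          (Fin.cons (s 0 x') (Fin.cons (s 1 y') (Fin.cons (s 2 z') finZeroElim)))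
        refine Iff.trans h ⟨?_, ?_⟩
        · rintro ⟨g, hg⟩
          refine ⟨Ψ g, ⟨g, rfl⟩, ?_, ?_, ?_⟩
          · have h0 := hg 0
            simp only [Fin.cons_zero, hs] at h0
            exact h0
          · have h1 : (θ 1 g : Equiv.Perm (C' 1)) (q 1 (s 1 y)) = q 1 (s 1 y') := hg 1
            rw [hs, hs] at h1
            exact h1
          · have h2 : (θ 2 g : Equiv.Perm (C' 2)) (q 2 (s 2 z)) = q 2 (s 2 z') := hg 2
            rw [hs, hs] at h2
            exact h2
        · rintro ⟨_, ⟨g, rfl⟩, h0, h1, h2⟩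
          refine ⟨g, fun i => ?_⟩
          fin_cases i
          · change (θ 0 g : Equiv.Perm (C' 0)) (q 0 (s 0 x)) = q 0 (s 0 x')
            rw [hs, hs]; exact h0
          · change (θ 1 g : Equiv.Perm (C' 1)) (q 1 (s 1 y)) = q 1 (s 1 y')
            rw [hs, hs]; exact h1
          · change (θ 2 g : Equiv.Perm (C' 2)) (q 2 (s 2 z)) = q 2 (s 2 z')
            rw [hs, hs]; exact h2 }
  refine ⟨S, ?_, q, Ψ.rangeRestrict, fun k => ⟨Function.RightInverse.surjective (hs k), hld k,
    hfib k⟩, Ψ.rangeRestrict_surjective, (Ψ.ker_rangeRestrict).trans hker, fun k g x => hθ k g x,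
    hproj'⟩
  intro i j hij
  rw [eq_bot_iff]
  rintro ⟨_, ⟨g, rfl⟩⟩ ⟨hgi, hgj⟩
  -- Acting trivially on a quotient curve means agreeing pointwise with deck transformations, hence
  -- with a single one on the whole curve.
  have hu : ∀ k, θ k g = 1 → ∃ l ∈ R.otherKernels k, ∀ x, R.act l k x = R.act g k x :=
    fun k hk => exists_uniform fun x => (hfib k _ _).1 (((htriv k g).1 hk x).symm)
  obtain ⟨l, hl, hlg⟩ := hu i hgi
  obtain ⟨m, hm, hmg⟩ := hu j hgj
  obtain ⟨k, hk⟩ := (by decide : ∀ i j : Fin 3, i < j → ∃ k, ∀ a, a ≠ k → a = i ∨ a = j) i j hij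
  -- `m` is trivial on `C i` and `l` is trivial on `C j`, so `l * m` acts as `g` on both and the
  -- quotient element fixes the two curves other than `C k`.
  have hmem : (l * m)⁻¹ * g ∈ R.otherKernels k := mem_otherKernels.2 fun a ha x => by
    have hag : R.act g a x = R.act (l * m) a x := by
      rw [act_mul]
      obtain rfl | rfl := hk a ha
      · rw [mem_otherKernels.1 hm a hij.ne, hlg]
      · rw [mem_otherKernels.1 hl a hij.ne', hmg]
    rw [act_mul, hag, ← act_mul, inv_mul_cancel]
    simp [act]
  refine Subgroup.mem_bot.2 (Subtype.ext (MonoidHom.mem_ker.1 (hle ?_)))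
  rw [← mul_inv_cancel_left (l * m) g]
  exact mul_mem (mul_mem (Subgroup.mem_iSup_of_mem i hl) (Subgroup.mem_iSup_of_mem j hm))
    (Subgroup.mem_iSup_of_mem k hmem)

end Realization

end

/-- Every threefold `X` isogenous to a product (of unmixed type) has a minimal realization; more
precisely, from any realization `R` of `X` one gets a minimal one by quotienting the factors by
the pairwise intersections of the kernels. -/
theorem proposition3p2 (X : Type v) [TopologicalSpace X]
    [ChartedSpace (EuclideanSpace ℂ (Fin 3)) X]
    [IsManifold 𝓘(ℂ, EuclideanSpace ℂ (Fin 3)) ω X] (R : Realization.{u} X) :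
    ∃ S : Realization.{u} X, S.IsMinimal ∧ R.IsQuotientByOtherKernels S :=
  R.exists_isMinimal_isQuotientByOtherKernels
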